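/- For an integer $n\ge 0$ let $\tilde U_A$ be an $n$-qubit unitary, $\Pi'$ an $n$-qubit orthogonal projector and $|\varphi_0\rangle,|\psi\rangle$ normalized $n$-qubit states. For an $n$-qubit orthogonal projector $\Pi$ write $\mathrm{C}_{\Pi}\mathrm{NOT}=X\otimes\Pi+I\otimes(I-\Pi)$, acting on one ancilla qubit together with the $n$-qubit register. Consider circuits on these $n+1$ qubits, i.e. finite sequences of gates, each of which is $I\otimes\tilde U_A$, $I\otimes\tilde U_A^{\dagger}$, $\mathrm{C}_{\Pi'}\mathrm{NOT}$, $\mathrm{C}_{|\varphi_0\rangle\langle\varphi_0|}\mathrm{NOT}$, or a rotation $e^{-i\theta X/2}$, $e^{-i\theta Y/2}$ or $e^{-i\theta Z/2}$ ($\theta\in\mathbb R$) of the ancilla qubit. For every $\epsilon_0<1$ there is a constant $C>0$, depending only on $\epsilon_0$, such that for all $\delta>0$ and $0<\epsilon\le\epsilon_0$ there is such a sequence of gates, of total length at most $C\,\delta^{-1}\log(1/\epsilon)$, whose gate types and rotation angles depend only on $\delta$ and $\epsilon$, with the following property. For all $n,\tilde U_A,\Pi',|\varphi_0\rangle,|\psi\rangle$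 as above and all real $a$ with $$\Pi'\tilde U_A|\varphi_0\rangle=a|\psi\rangle,\qquad a>\delta,$$ the $(n+1)$-qubit operator $U_\Phi$ implemented by the sequence is unitary and satisfies $$\bigl\|\,|0\rangle|\psi\rangle-U_\Phi|0\rangle|\varphi_0\rangle\,\bigr\|\le\epsilon .$$ -/

import Mathlib

open scoped Kronecker

noncomputable section

namespace FixedPointAA

/-- Computational basis labels of an `n`-qubit register. -/
abbrev Bits (n : ℕ) : Type := Fin n → Fin 2

/-- The state space `(ℂ²)^{⊗ n}` of an `n`-qubit register, with the 2-norm. -/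
abbrev Reg (n : ℕ) : Type := EuclideanSpace ℂ (Bits n)

/-- Operators on an `n`-qubit register, in the computational basis. -/
abbrev Op (n : ℕ) : Type := Matrix (Bits n) (Bits n) ℂ

/-- The state space `ℂ² ⊗ (ℂ²)^{⊗ n}` of `n + 1` qubits: one ancilla qubit, then the register. -/
abbrev AncReg (n : ℕ) : Type := EuclideanSpace ℂ (Fin 2 × Bits n)

/-- Operators on the ancilla qubit together with the register. -/
abbrev AncOp (n : ℕ) : Type := Matrix (Fin 2 × Bits n) (Fin 2 × Bits n) ℂ

/-- The product state `|0⟩|v⟩`. -/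
def ketZero {n : ℕ} (v : Reg n) : AncReg n :=
  WithLp.toLp 2 fun p => if p.1 = 0 then v p.2 else 0

/-- The operator `|v⟩⟨v|`. -/
def ketBra {n : ℕ} (v : Reg n) : Op n :=
  Matrix.of fun i j => v i * star (v j)

/-- The Pauli matrix `X`. -/
def pauliX : Matrix (Fin 2) (Fin 2) ℂ := !![0, 1; 1, 0]

/-- `C_P NOT = X ⊗ P + I ⊗ (I - P)`: the ancilla is flipped on the range of `P`. -/
def cNot {n : ℕ} (P : Op n) : AncOp n :=
  pauliX ⊗ₖ P + (1 : Matrix (Fin 2) (Fin 2) ℂ) ⊗ₖ (1 - P)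

/-- The rotation `exp (-i θ X / 2)`. -/
def rotX (θ : ℝ) : Matrix (Fin 2) (Fin 2) ℂ :=
  !![(Real.cos (θ / 2) : ℂ), -Complex.I * (Real.sin (θ / 2) : ℂ);
     -Complex.I * (Real.sin (θ / 2) : ℂ), (Real.cos (θ / 2) : ℂ)]

/-- The rotation `exp (-i θ Y / 2)`. -/
def rotY (θ : ℝ) : Matrix (Fin 2) (Fin 2) ℂ :=
  !![(Real.cos (θ / 2) : ℂ), -(Real.sin (θ / 2) : ℂ);
     (Real.sin (θ / 2) : ℂ), (Real.cos (θ / 2) : ℂ)]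

/-- The rotation `exp (-i θ Z / 2)`. -/
def rotZ (θ : ℝ) : Matrix (Fin 2) (Fin 2) ℂ :=
  !![Complex.exp (-(Complex.I * (θ / 2 : ℂ))), 0;
     0, Complex.exp (Complex.I * (θ / 2 : ℂ))]

/-- Names of the available gates; the rotations act on the ancilla qubit. -/
inductive Gate : Type
  | oracle : Gate
  | oracleAdj : Gate
  | cNotTarget : Gate
  | cNotInit : Gate
  | rotX (θ : ℝ) : Gate
  | rotY (θ : ℝ) : Gate
  | rotZ (θ : ℝ) : Gate

/-- The operator that a gate stands for, given the unitary `U`, the projector `P` and the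
initial state `φ`. -/
def Gate.toOp {n : ℕ} (U P : Op n) (φ : Reg n) : Gate → AncOp n
  | .oracle => (1 : Matrix (Fin 2) (Fin 2) ℂ) ⊗ₖ U
  | .oracleAdj => (1 : Matrix (Fin 2) (Fin 2) ℂ) ⊗ₖ U.conjTranspose
  | .cNotTarget => cNot P
  | .cNotInit => cNot (ketBra φ)
  | .rotX θ => FixedPointAA.rotX θ ⊗ₖ (1 : Op n)
  | .rotY θ => FixedPointAA.rotY θ ⊗ₖ (1 : Op n)
  | .rotZ θ => FixedPointAA.rotZ θ ⊗ₖ (1 : Op n)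

/-- A circuit is a finite sequence of gates; its head acts first. -/
abbrev Circuit : Type := List Gate

/-- The operator on `n + 1` qubits implemented by a circuit. -/
def Circuit.toOp {n : ℕ} (U P : Op n) (φ : Reg n) : Circuit → AncOp n
  | [] => 1
  | g :: c => Circuit.toOp U P φ c * g.toOp U P φ

end FixedPointAA

end

/-! The proof combines quantum signal processing with a polynomial approximation of the sign
function. Write `φ⊥ = U†ψ - aφ` and `ψ⊥ = Uφ - aψ`. The oracle carries the span of `φ, φ⊥` to the
span of `ψ, ψ⊥` by a real 2×2 matrix depending only on `a`, and a Z-rotation between two equal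
controlled NOTs puts opposite phases on the two basis vectors. Alternating oracles and phases
therefore yields amplitudes polynomial in `a`, whose coefficients are fixed by the angles alone.

Conversely, any pair with `y|S|² + (1-y)|Q|² = 1`, where `y = a²`, arises in this way: equality of
the leading moduli lets one phase lower the degree, and induction peels off the circuit
(`exists_oddReal`). If `x p(x²)` is real with modulus below 1 on `[0, 1]`, then Lukács' theorem
(`oddForm_of_pos`) writes `1 - y p²` as `y s² + (1-y) q²`, so `p + is` and `q` form such a pair. The
ancilla branch `|1⟩` carries the conjugate amplitudes, hence preparing and measuring the ancilla in
`|+⟩` extracts the real part `a p(a²)` as the overlap with the target; for unit vectors this overlap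
determines the error.

It remains to find an odd polynomial, bounded by 1, close to 1 on `[δ, 1]` and of degree `O(δ⁻¹
log(1/ε))` (`exists_amplifying_poly`). It is a composition: an integrated squared Dirichlet kernel
of degree `O(1/δ)` lifts `[δ, 1]` into `[1/2, 1]`, then a polynomial of degree `O(log(1/ε))` pushes
`[1/2, 1]` to near 1. -/

namespace FixedPointAA

/-! ### Lukács' theorem on positive polynomials over `[0, 1]` -/

open Polynomial

/-- `R = S² + y (1 - y) Q²` with `deg S ≤ m` and `deg Q ≤ m - 1`. -/
def EvenForm (m : ℕ) (R : ℝ[X]) : Prop :=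
  ∃ S Q : ℝ[X], S.natDegree ≤ m ∧ (X * Q).natDegree ≤ m ∧ R = S ^ 2 + X * (1 - X) * Q ^ 2

/-- `R = y S² + (1 - y) Q²` with `deg S, deg Q ≤ m`. -/
def OddForm (m : ℕ) (R : ℝ[X]) : Prop :=
  ∃ S Q : ℝ[X], S.natDegree ≤ m ∧ Q.natDegree ≤ m ∧ R = X * S ^ 2 + (1 - X) * Q ^ 2

lemma natDegree_one_sub_X_mul_le {K : Type*} [CommRing K] [IsDomain K] {m : ℕ} {Q : K[X]}
    (h : (X * Q).natDegree ≤ m) : ((1 - X) * Q).natDegree ≤ m := by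
  rcases eq_or_ne Q 0 with rfl | hQ
  · simp
  have h1 : Q.natDegree ≤ m := by
    rw [natDegree_X_mul hQ] at h
    omega
  rw [sub_mul, one_mul]
  exact natDegree_sub_le_of_le h1 h |>.trans (by simp)

lemma natDegree_one_sub_X_mul_le_succ {K : Type*} [CommRing K] [IsDomain K] {m : ℕ} {Q : K[X]}
    (h : Q.natDegree ≤ m) : ((1 - X) * Q).natDegree ≤ m + 1 := by
  apply natDegree_one_sub_X_mul_le
  rw [add_comm]
  exact natDegree_mul_le_of_le natDegree_X_le h

/-- An odd form is `|√y S + i√(1-y) Q|²` and an even form is `|S + i√(y(1-y)) Q|²`. Multiplying the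
complex numbers inside the moduli gives the witnesses here and in the next two lemmas. -/
lemma OddForm.mul {m k : ℕ} {R T : ℝ[X]} (hR : OddForm m R) (hT : OddForm k T) :
    EvenForm (m + k + 1) (R * T) := by
  obtain ⟨S₁, Q₁, hS₁, hQ₁, rfl⟩ := hR
  obtain ⟨S₂, Q₂, hS₂, hQ₂, rfl⟩ := hT
  refine ⟨X * (S₁ * S₂) - (1 - X) * (Q₁ * Q₂), S₁ * Q₂ + Q₁ * S₂, ?_, ?_, by ring⟩
  · refine (natDegree_sub_le_of_le (m := m + k + 1) (n := m + k + 1) ?_ ?_).trans (by simp)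
    · rw [add_comm (m + k)]
      exact natDegree_mul_le_of_le natDegree_X_le (natDegree_mul_le_of_le hS₁ hS₂)
    · exact natDegree_one_sub_X_mul_le_succ (natDegree_mul_le_of_le hQ₁ hQ₂)
  · rw [add_comm (m + k)]
    exact natDegree_mul_le_of_le natDegree_X_le (natDegree_add_le_of_degree_le
      (natDegree_mul_le_of_le hS₁ hQ₂) (natDegree_mul_le_of_le hQ₁ hS₂))

lemma EvenForm.mul_odd {m k : ℕ} {R T : ℝ[X]} (hR : EvenForm m R) (hT : OddForm k T) :
    OddForm (m + k) (R * T) := by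
  obtain ⟨S₁, Q₁, hS₁, hQ₁, rfl⟩ := hR
  obtain ⟨S₂, Q₂, hS₂, hQ₂, rfl⟩ := hT
  refine ⟨S₁ * S₂ - (1 - X) * Q₁ * Q₂, S₁ * Q₂ + X * Q₁ * S₂, ?_, ?_, by ring⟩
  · refine (natDegree_sub_le_of_le (m := m + k) (n := m + k) ?_ ?_).trans (by simp)
    · exact natDegree_mul_le_of_le hS₁ hS₂
    · exact natDegree_mul_le_of_le (natDegree_one_sub_X_mul_le hQ₁) hQ₂
  · exact natDegree_add_le_of_degree_le (natDegree_mul_le_of_le hS₁ hQ₂)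
      (natDegree_mul_le_of_le hQ₁ hS₂)

lemma EvenForm.mul {m k : ℕ} {R T : ℝ[X]} (hR : EvenForm m R) (hT : EvenForm k T) :
    EvenForm (m + k) (R * T) := by
  obtain ⟨S₁, Q₁, hS₁, hQ₁, rfl⟩ := hR
  obtain ⟨S₂, Q₂, hS₂, hQ₂, rfl⟩ := hT
  refine ⟨S₁ * S₂ - X * Q₁ * ((1 - X) * Q₂), S₁ * Q₂ + Q₁ * S₂, ?_, ?_, by ring⟩
  · refine (natDegree_sub_le_of_le (m := m + k) (n := m + k) ?_ ?_).trans (by simp)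
    · exact natDegree_mul_le_of_le hS₁ hS₂
    · exact natDegree_mul_le_of_le hQ₁ (natDegree_one_sub_X_mul_le hQ₂)
  · have : X * (S₁ * Q₂ + Q₁ * S₂) = S₁ * (X * Q₂) + X * Q₁ * S₂ := by ring
    rw [this]
    exact natDegree_add_le_of_degree_le (natDegree_mul_le_of_le hS₁ hQ₂)
      (natDegree_mul_le_of_le hQ₁ hS₂)

lemma evenForm_C {r : ℝ} (hr : 0 ≤ r) : EvenForm 0 (C r) :=
  ⟨C √r, 0, by simp, by simp, by simp [← C_pow, Real.sq_sqrt hr]⟩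

lemma oddForm_linear {s q : ℝ} (hs : 0 ≤ s) (hq : 0 ≤ q) :
    OddForm 0 (X * C s + (1 - X) * C q) :=
  ⟨C √s, C √q, by simp, by simp, by simp [← C_pow, Real.sq_sqrt hs, Real.sq_sqrt hq]⟩

/-- With `z = u + iv`, the quadratic takes the values `β² = |z|²` at 0 and `γ² = |1-z|²` at 1, so a
linear `S` running from `β` to `-γ` matches both ends. The remainder is `κ y(1-y)`, and `κ ≥ 0` is
the triangle inequality `|z| + |1-z| ≥ 1`. -/
lemma evenForm_quadratic (u v : ℝ) : EvenForm 1 ((X - C u) ^ 2 + C (v ^ 2)) := by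
  set β := √(u ^ 2 + v ^ 2)
  set γ := √((1 - u) ^ 2 + v ^ 2)
  have hβ : β ^ 2 = u ^ 2 + v ^ 2 := Real.sq_sqrt (by positivity)
  have hγ : γ ^ 2 = (1 - u) ^ 2 + v ^ 2 := Real.sq_sqrt (by positivity)
  have hβu : |u| ≤ β := Real.abs_le_sqrt (by nlinarith [sq_nonneg v])
  have hγu : |1 - u| ≤ γ := Real.abs_le_sqrt (by nlinarith [sq_nonneg v])
  have h1 : 1 ≤ β + γ := by linarith [le_abs_self u, le_abs_self (1 - u)]
  set κ := (β + γ) ^ 2 - 1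
  have hκ : √κ ^ 2 = κ := Real.sq_sqrt (by simp only [κ]; nlinarith)
  refine ⟨C β - C (β + γ) * X, C √κ, ?_, ?_, ?_⟩
  · compute_degree
  · compute_degree
  · apply Polynomial.funext
    intro y
    simp only [eval_add, eval_pow, eval_sub, eval_X, eval_C, eval_mul, eval_one, hκ, κ]
    linear_combination (y ^ 2 - 1 - (y ^ 2 - y)) * hβ + (- y) * hγ

/-- A real polynomial that is positive on `[0, 1]` is a weighted sum of two squares. -/
theorem evenForm_or_oddForm_of_pos (d : ℕ) : ∀ R : ℝ[X], R.natDegree = d →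
    (∀ y ∈ Set.Icc (0 : ℝ) 1, 0 < R.eval y) →
    (∃ m, d = 2 * m ∧ EvenForm m R) ∨ (∃ m, d = 2 * m + 1 ∧ OddForm m R) := by
  induction d using Nat.strong_induction_on with
  | _ d ih =>
  intro R hd hpos
  rcases Nat.eq_zero_or_pos d with rfl | hd0
  · left
    rw [natDegree_eq_zero] at hd
    obtain ⟨r, rfl⟩ := hd
    refine ⟨0, rfl, evenForm_C ?_⟩
    simpa using (hpos 0 (by simp)).le
  have hR0 : R ≠ 0 := by rintro rfl; simp at hd; omega
  obtain ⟨z, hz⟩ : ∃ z : ℂ, aeval z R = 0 := by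
    apply IsAlgClosed.exists_aeval_eq_zero
    rw [degree_eq_natDegree hR0, hd]
    exact_mod_cast hd0.ne'
  have step : ∀ (g h : ℝ[X]), R = g * h → (∀ y ∈ Set.Icc (0 : ℝ) 1, 0 < g.eval y) →
      ∀ y ∈ Set.Icc (0 : ℝ) 1, 0 < h.eval y := by
    rintro g h rfl hg y hy
    have := hpos y hy
    rw [eval_mul] at this
    exact (pos_iff_pos_of_mul_pos this).1 (hg y hy)
  -- Induction on the degree: split off a factor positive on `[0, 1]`, either linear (a real root,
  -- which lies outside the interval) or quadratic (a conjugate pair). The cofactor is then positive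
  -- too, and the product lemmas track parity.
  have key : ∀ (g h : ℝ[X]), R = g * h → (∀ y ∈ Set.Icc (0 : ℝ) 1, 0 < g.eval y) →
      (g.natDegree = 1 ∧ OddForm 0 g ∨ g.natDegree = 2 ∧ EvenForm 1 g) →
      (∃ m, d = 2 * m ∧ EvenForm m R) ∨ (∃ m, d = 2 * m + 1 ∧ OddForm m R) := by
    intro g h hgh hg hform
    have hh := step g h hgh hg
    have hg0 : g ≠ 0 := by rintro rfl; simp at hgh; exact hR0 hgh
    have hh0 : h ≠ 0 := by rintro rfl; simp at hgh; exact hR0 hgh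
    have hdeg : d = g.natDegree + h.natDegree := by rw [← hd, hgh, natDegree_mul hg0 hh0]
    have hih := ih h.natDegree (by omega) h rfl hh
    rcases hform with ⟨hg1, hgf⟩ | ⟨hg2, hgf⟩ <;> rcases hih with ⟨m, hm, hf⟩ | ⟨m, hm, hf⟩
    · exact Or.inr ⟨m, by omega, by simpa [hgh, mul_comm] using hf.mul_odd hgf⟩
    · exact Or.inl ⟨m + 1, by omega, by simpa [hgh, mul_comm] using hf.mul hgf⟩
    · exact Or.inl ⟨m + 1, by omega, by simpa [hgh, mul_comm] using hf.mul hgf⟩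
    · exact Or.inr ⟨1 + m, by omega, by simpa [hgh] using hgf.mul_odd hf⟩
  by_cases him : z.im = 0
  · have hzr : (z.re : ℂ) = z := Complex.ext rfl (by simp [him])
    have hroot : R.IsRoot z.re := by
      rw [← hzr] at hz
      have : ((R.eval z.re : ℝ) : ℂ) = 0 := by
        rw [← hz]
        simpa using (aeval_algebraMap_apply ℂ z.re R).symm
      exact_mod_cast this
    obtain ⟨h, hh⟩ := dvd_iff_isRoot.2 hroot
    have hout : z.re < 0 ∨ 1 < z.re := by
      by_contra! hcon
      exact (hpos z.re ⟨hcon.1, hcon.2⟩).ne' hroot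
    rcases hout with hr | hr
    · refine key _ h hh (fun y hy => by simp; linarith [hy.1]) (Or.inl ⟨natDegree_X_sub_C _, ?_⟩)
      have : X - C z.re = X * C (1 - z.re) + (1 - X) * C (-z.re) := by
        simp only [C_sub, C_neg, C_1]; ring
      rw [this]
      exact oddForm_linear (by linarith) (by linarith)
    · refine key (C z.re - X) (-h) (by rw [hh]; ring) (fun y hy => by simp; linarith [hy.2])
        (Or.inl ⟨?_, ?_⟩)
      · rw [← natDegree_neg, neg_sub, natDegree_X_sub_C]
      have : C z.re - X = X * C (z.re - 1) + (1 - X) * C z.re := by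
        simp only [C_sub, C_1]; ring
      rw [this]
      exact oddForm_linear (by linarith) (by linarith)
  · obtain ⟨h, hh⟩ := quadratic_dvd_of_aeval_eq_zero_im_ne_zero R hz him
    have hq : X ^ 2 - C (2 * z.re) * X + C (‖z‖ ^ 2) = (X - C z.re) ^ 2 + C (z.im ^ 2) := by
      rw [← Complex.normSq_eq_norm_sq, Complex.normSq_apply]
      simp only [C_add, C_mul, C_pow, C_ofNat]
      ring
    rw [hq] at hh
    refine key _ h hh (fun y hy => ?_) (Or.inr ⟨?_, evenForm_quadratic _ _⟩)
    · simp only [eval_add, eval_pow, eval_sub, eval_X, eval_C]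
      have : 0 < z.im ^ 2 := by positivity
      positivity
    · compute_degree!

lemma OddForm.mono {m k : ℕ} {R : ℝ[X]} (h : OddForm m R) (hmk : m ≤ k) : OddForm k R := by
  obtain ⟨S, Q, hS, hQ, rfl⟩ := h
  exact ⟨S, Q, hS.trans hmk, hQ.trans hmk, rfl⟩

/-- **Lukács' theorem** for strictly positive polynomials of degree at most `2 N + 1`. -/
theorem oddForm_of_pos {N : ℕ} {R : ℝ[X]} (hdeg : R.natDegree ≤ 2 * N + 1)
    (hpos : ∀ y ∈ Set.Icc (0 : ℝ) 1, 0 < R.eval y) : OddForm N R := by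
  rcases evenForm_or_oddForm_of_pos _ R rfl hpos with ⟨m, hm, h⟩ | ⟨m, hm, h⟩
  -- Multiplying by `1 = y + (1 - y)`, itself an odd form of order 0, turns an even form into an odd
  -- one.
  · have h1 := h.mul_odd (oddForm_linear zero_le_one zero_le_one)
    have : R * (X * C 1 + (1 - X) * C 1) = R := by simp only [C_1]; ring
    rw [this] at h1
    exact h1.mono (by omega)
  · exact h.mono (by omega)

end FixedPointAA

/-! ### Action of the gates on the two-dimensional spaces of the problem -/

namespace FixedPointAA

open Matrix

/-- The product state `|w⟩|v⟩` of an ancilla vector and a register vector. -/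
noncomputable def prodKet {n : ℕ} (w : Fin 2 → ℂ) (v : Reg n) : AncReg n :=
  WithLp.toLp 2 fun p => w p.1 * v p.2

section prodKet

variable {n : ℕ}

lemma prodKet_add_right (w : Fin 2 → ℂ) (v v' : Reg n) :
    prodKet w (v + v') = prodKet w v + prodKet w v' := by
  ext p; simp [prodKet, mul_add]

lemma prodKet_add_left (w w' : Fin 2 → ℂ) (v : Reg n) :
    prodKet (w + w') v = prodKet w v + prodKet w' v := by
  ext p; simp [prodKet, add_mul]

lemma prodKet_smul_right (c : ℂ) (w : Fin 2 → ℂ) (v : Reg n) :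
    prodKet w (c • v) = c • prodKet w v := by
  ext p; simp [prodKet]; ring

lemma prodKet_smul_left (c : ℂ) (w : Fin 2 → ℂ) (v : Reg n) :
    prodKet (c • w) v = c • prodKet w v := by
  ext p; simp [prodKet]; ring

lemma prodKet_zero_right (w : Fin 2 → ℂ) : prodKet w (0 : Reg n) = 0 := by
  ext p; simp [prodKet]

lemma ketZero_eq_prodKet (v : Reg n) : ketZero v = prodKet ![1, 0] v := by
  ext ⟨i, j⟩
  fin_cases i <;> simp [ketZero, prodKet]

lemma kronecker_prodKet (A : Matrix (Fin 2) (Fin 2) ℂ) (B : Op n) (w : Fin 2 → ℂ) (v : Reg n) :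
    toEuclideanLin (A ⊗ₖ B) (prodKet w v) = prodKet (A *ᵥ w) (toEuclideanLin B v) := by
  ext ⟨i, j⟩
  simp only [toLpLin_apply, prodKet, mulVec, dotProduct, Fintype.sum_prod_type, kroneckerMap_apply,
    Finset.sum_mul_sum]
  refine Finset.sum_congr rfl fun _ _ => Finset.sum_congr rfl fun _ _ => by ring

lemma cNot_prodKet (P : Op n) (w : Fin 2 → ℂ) (v : Reg n) :
    toEuclideanLin (cNot P) (prodKet w v) =
      prodKet (pauliX *ᵥ w) (toEuclideanLin P v) + prodKet w (v - toEuclideanLin P v) := by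
  simp [cNot, kronecker_prodKet]

lemma cNot_prodKet_of_fixed {P : Op n} (w : Fin 2 → ℂ) {v : Reg n} (h : toEuclideanLin P v = v) :
    toEuclideanLin (cNot P) (prodKet w v) = prodKet (pauliX *ᵥ w) v := by
  rw [cNot_prodKet, h, sub_self, prodKet_zero_right, add_zero]

lemma cNot_prodKet_of_kernel {P : Op n} (w : Fin 2 → ℂ) {v : Reg n} (h : toEuclideanLin P v = 0) :
    toEuclideanLin (cNot P) (prodKet w v) = prodKet w v := by
  rw [cNot_prodKet, h, sub_zero, prodKet_zero_right, zero_add]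

end prodKet

lemma pauliX_mulVec_zero : pauliX *ᵥ ![1, 0] = ![0, 1] := by
  ext i; fin_cases i <;> simp [pauliX, mulVec, dotProduct]

lemma pauliX_mulVec_one : pauliX *ᵥ ![0, 1] = ![1, 0] := by
  ext i; fin_cases i <;> simp [pauliX, mulVec, dotProduct]

lemma rotZ_mulVec_zero (t : ℝ) :
    rotZ (2 * t) *ᵥ ![1, 0] = Complex.exp (-(t * Complex.I)) • ![1, 0] := by
  ext i; fin_cases i <;> simp [rotZ, mulVec, dotProduct, mul_comm]

lemma rotZ_mulVec_one (t : ℝ) :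
    rotZ (2 * t) *ᵥ ![0, 1] = Complex.exp (t * Complex.I) • ![0, 1] := by
  ext i; fin_cases i <;> simp [rotZ, mulVec, dotProduct, mul_comm]

section phase

variable {n : ℕ} {P : Op n}

/-- `C_P NOT · e^{-i t Z} · C_P NOT`. -/
noncomputable def phaseOp (P : Op n) (t : ℝ) : AncOp n :=
  cNot P * (rotZ (2 * t) ⊗ₖ (1 : Op n)) * cNot P

lemma toEuclideanLin_mul_apply {ι : Type*} [Fintype ι] [DecidableEq ι] (A B : Matrix ι ι ℂ)
    (v : EuclideanSpace ℂ ι) :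
    toEuclideanLin (A * B) v = toEuclideanLin A (toEuclideanLin B v) := by
  simp [toLpLin_mul_same]

/-- The controlled NOTs swap the two eigenvalues of the Z-rotation exactly on the range of `P`. So
the operator acts as `exp(it(2P-1))` on ancilla `|0⟩` and as the inverse on `|1⟩`; this lemma and
the next three are the four cases. -/
lemma phaseOp_zero_of_fixed (t : ℝ) {v : Reg n} (h : toEuclideanLin P v = v) :
    toEuclideanLin (phaseOp P t) (prodKet ![1, 0] v) =
      Complex.exp (t * Complex.I) • prodKet ![1, 0] v := by
  rw [phaseOp, toEuclideanLin_mul_apply, toEuclideanLin_mul_apply, cNot_prodKet_of_fixed _ h,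
    kronecker_prodKet, pauliX_mulVec_zero, rotZ_mulVec_one, prodKet_smul_left, map_smul]
  simp only [toLpLin_one, LinearMap.id_apply]
  rw [cNot_prodKet_of_fixed _ h, pauliX_mulVec_one]

lemma phaseOp_one_of_fixed (t : ℝ) {v : Reg n} (h : toEuclideanLin P v = v) :
    toEuclideanLin (phaseOp P t) (prodKet ![0, 1] v) =
      Complex.exp (-(t * Complex.I)) • prodKet ![0, 1] v := by
  rw [phaseOp, toEuclideanLin_mul_apply, toEuclideanLin_mul_apply, cNot_prodKet_of_fixed _ h,
    kronecker_prodKet, pauliX_mulVec_one, rotZ_mulVec_zero, prodKet_smul_left, map_smul]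
  simp only [toLpLin_one, LinearMap.id_apply]
  rw [cNot_prodKet_of_fixed _ h, pauliX_mulVec_zero]

lemma phaseOp_zero_of_kernel (t : ℝ) {v : Reg n} (h : toEuclideanLin P v = 0) :
    toEuclideanLin (phaseOp P t) (prodKet ![1, 0] v) =
      Complex.exp (-(t * Complex.I)) • prodKet ![1, 0] v := by
  rw [phaseOp, toEuclideanLin_mul_apply, toEuclideanLin_mul_apply, cNot_prodKet_of_kernel _ h,
    kronecker_prodKet, rotZ_mulVec_zero, prodKet_smul_left, map_smul]
  simp only [toLpLin_one, LinearMap.id_apply]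
  rw [cNot_prodKet_of_kernel _ h]

lemma phaseOp_one_of_kernel (t : ℝ) {v : Reg n} (h : toEuclideanLin P v = 0) :
    toEuclideanLin (phaseOp P t) (prodKet ![0, 1] v) =
      Complex.exp (t * Complex.I) • prodKet ![0, 1] v := by
  rw [phaseOp, toEuclideanLin_mul_apply, toEuclideanLin_mul_apply, cNot_prodKet_of_kernel _ h,
    kronecker_prodKet, rotZ_mulVec_one, prodKet_smul_left, map_smul]
  simp only [toLpLin_one, LinearMap.id_apply]
  rw [cNot_prodKet_of_kernel _ h]

end phase

/-- The data of an amplitude amplification problem. -/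
structure Problem {n : ℕ} (U P : Op n) (φ ψ : Reg n) (a : ℝ) : Prop where
  unitary : U ∈ unitaryGroup (Bits n) ℂ
  proj : IsStarProjection P
  norm_init : ‖φ‖ = 1
  norm_target : ‖ψ‖ = 1
  pos : 0 < a
  apply_eq : toEuclideanLin P (toEuclideanLin U φ) = (a : ℂ) • ψ

/-- The component `U†ψ - a φ` of `U†ψ` orthogonal to the initial state. -/
noncomputable def initPerp {n : ℕ} (U : Op n) (φ ψ : Reg n) (a : ℝ) : Reg n :=
  toEuclideanLin Uᴴ ψ - (a : ℂ) • φ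

/-- The component `U φ - a ψ` of `U φ` orthogonal to the target state. -/
noncomputable def targetPerp {n : ℕ} (U : Op n) (φ ψ : Reg n) (a : ℝ) : Reg n :=
  toEuclideanLin U φ - (a : ℂ) • ψ

lemma inner_toEuclideanLin_left {ι : Type*} [Fintype ι] [DecidableEq ι] (A : Matrix ι ι ℂ)
    (v w : EuclideanSpace ℂ ι) :
    inner ℂ (toEuclideanLin A v) w = inner ℂ v (toEuclideanLin Aᴴ w) := by
  rw [toEuclideanLin_conjTranspose_eq_adjoint, LinearMap.adjoint_inner_right]

lemma ketBra_apply {n : ℕ} (φ v : Reg n) :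
    toEuclideanLin (ketBra φ) v = (inner ℂ φ v : ℂ) • φ := by
  ext i
  simp only [toLpLin_apply, mulVec, dotProduct, ketBra, of_apply, PiLp.smul_apply, smul_eq_mul,
    PiLp.inner_apply, RCLike.inner_apply, Finset.sum_mul]
  refine Finset.sum_congr rfl fun j _ => ?_
  simp; ring

lemma isStarProjection_ketBra {n : ℕ} {φ : Reg n} (h : ‖φ‖ = 1) : IsStarProjection (ketBra φ) := by
  have h1 : ∑ j, star (φ j) * φ j = (1 : ℂ) := by
    have := inner_self_eq_norm_sq_to_K (𝕜 := ℂ) φ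
    rw [h, PiLp.inner_apply] at this
    simpa only [RCLike.inner_apply, mul_comm, starRingEnd_apply, RCLike.ofReal_one, one_pow]
      using this
  constructor
  · ext i k
    simp only [mul_apply, ketBra, of_apply]
    calc ∑ j, φ i * star (φ j) * (φ j * star (φ k))
        = φ i * star (φ k) * ∑ j, star (φ j) * φ j := by
          rw [Finset.mul_sum]; exact Finset.sum_congr rfl fun _ _ => by ring
      _ = _ := by rw [h1, mul_one]
  · ext i k
    simp [ketBra, star_apply, mul_comm]

namespace Problem

variable {n : ℕ} {U P : Op n} {φ ψ : Reg n} {a : ℝ}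

lemma adj_apply (h : Problem U P φ ψ a) (v : Reg n) :
    toEuclideanLin Uᴴ (toEuclideanLin U v) = v := by
  rw [← toEuclideanLin_mul_apply, ← star_eq_conjTranspose, (mem_unitaryGroup_iff'.1 h.unitary)]
  simp

lemma apply_adj (h : Problem U P φ ψ a) (v : Reg n) :
    toEuclideanLin U (toEuclideanLin Uᴴ v) = v := by
  rw [← toEuclideanLin_mul_apply, ← star_eq_conjTranspose, (mem_unitaryGroup_iff.1 h.unitary)]
  simp

lemma ne_zero (h : Problem U P φ ψ a) : (a : ℂ) ≠ 0 := by exact_mod_cast h.pos.ne'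

lemma proj_target (h : Problem U P φ ψ a) : toEuclideanLin P ψ = ψ := by
  have h1 : ψ = (a : ℂ)⁻¹ • toEuclideanLin P (toEuclideanLin U φ) := by
    rw [h.apply_eq, smul_smul, inv_mul_cancel₀ h.ne_zero, one_smul]
  conv_lhs => rw [h1]
  rw [map_smul, ← toEuclideanLin_mul_apply, h.proj.isIdempotentElem.eq, ← h1]

lemma proj_targetPerp (h : Problem U P φ ψ a) : toEuclideanLin P (targetPerp U φ ψ a) = 0 := by
  rw [targetPerp, map_sub, map_smul, h.proj_target, h.apply_eq, sub_self]

lemma inner_target_apply (h : Problem U P φ ψ a) : inner ℂ ψ (toEuclideanLin U φ) = (a : ℂ) := by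
  have hP : Pᴴ = P := h.proj.isSelfAdjoint
  have h1 : inner ℂ (toEuclideanLin P ψ) (toEuclideanLin U φ) = (a : ℂ) := by
    rw [inner_toEuclideanLin_left, hP, h.apply_eq, inner_smul_right, inner_self_eq_norm_sq_to_K,
      h.norm_target]
    simp
  rwa [h.proj_target] at h1

lemma ketBra_init (h : Problem U P φ ψ a) : toEuclideanLin (ketBra φ) φ = φ := by
  rw [ketBra_apply, inner_self_eq_norm_sq_to_K, h.norm_init]
  simp

lemma ketBra_initPerp (h : Problem U P φ ψ a) :
    toEuclideanLin (ketBra φ) (initPerp U φ ψ a) = 0 := by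
  have h1 : inner ℂ φ (toEuclideanLin Uᴴ ψ) = (a : ℂ) := by
    rw [← inner_toEuclideanLin_left, ← inner_conj_symm, h.inner_target_apply, Complex.conj_ofReal]
  rw [ketBra_apply, initPerp, inner_sub_right, inner_smul_right, inner_self_eq_norm_sq_to_K,
    h.norm_init, h1]
  simp

lemma inner_target_targetPerp (h : Problem U P φ ψ a) :
    inner ℂ ψ (targetPerp U φ ψ a) = (0 : ℂ) := by
  rw [targetPerp, inner_sub_right, inner_smul_right, inner_self_eq_norm_sq_to_K,
    h.norm_target, h.inner_target_apply]
  simp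

lemma apply_init : toEuclideanLin U φ = (a : ℂ) • ψ + targetPerp U φ ψ a := by
  simp [targetPerp]

lemma adj_target : toEuclideanLin Uᴴ ψ = (a : ℂ) • φ + initPerp U φ ψ a := by
  simp [initPerp]

/-- Since the perpendicular components are left unnormalised, the oracle has matrix `[[a, 1-a²], [1,
-a]]`: polynomial in `a`, with no special case at `a = 1`, and its own inverse. -/
lemma apply_initPerp (h : Problem U P φ ψ a) : toEuclideanLin U (initPerp U φ ψ a) =
    (1 - a ^ 2 : ℂ) • ψ - (a : ℂ) • targetPerp U φ ψ a := by
  rw [initPerp, map_sub, map_smul, h.apply_adj, apply_init (ψ := ψ) (a := a)]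
  module

lemma adj_targetPerp (h : Problem U P φ ψ a) : toEuclideanLin Uᴴ (targetPerp U φ ψ a) =
    (1 - a ^ 2 : ℂ) • φ - (a : ℂ) • initPerp U φ ψ a := by
  rw [targetPerp, map_sub, map_smul, h.adj_apply, adj_target (φ := φ) (a := a)]
  module

lemma amplitude_le_one (h : Problem U P φ ψ a) : a ≤ 1 := by
  have h1 : ‖(inner ℂ ψ (toEuclideanLin U φ) : ℂ)‖ ≤ ‖ψ‖ * ‖toEuclideanLin U φ‖ :=
    norm_inner_le_norm _ _
  have h2 : ‖toEuclideanLin U φ‖ = 1 := by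
    have : inner ℂ (toEuclideanLin U φ) (toEuclideanLin U φ) = (inner ℂ φ φ : ℂ) := by
      rw [inner_toEuclideanLin_left, h.adj_apply]
    rw [inner_self_eq_norm_sq_to_K, inner_self_eq_norm_sq_to_K, h.norm_init] at this
    have h3 : ‖toEuclideanLin U φ‖ ^ 2 = 1 ^ 2 := by exact_mod_cast this
    exact (pow_left_inj₀ (norm_nonneg _) zero_le_one two_ne_zero).1 h3
  rw [h.inner_target_apply, h2, h.norm_target, Complex.norm_real, Real.norm_eq_abs,
    abs_of_pos h.pos] at h1
  linarith

end Problem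

lemma Circuit.toOp_append {n : ℕ} (U P : Op n) (φ : Reg n) (c d : Circuit) :
    Circuit.toOp U P φ (c ++ d) = Circuit.toOp U P φ d * Circuit.toOp U P φ c := by
  induction c with
  | nil => simp [Circuit.toOp]
  | cons g c ih => simp only [List.cons_append, Circuit.toOp, ih, mul_assoc]

/-- The circuit maps the initial state to `f φ + g φ⊥` on ancilla `|0⟩`, and to the state with
conjugate amplitudes on ancilla `|1⟩`. -/
def EvenReal (Φ : Circuit) (f g : ℝ → ℂ) : Prop :=
  ∀ (n : ℕ) (U P : Op n) (φ ψ : Reg n) (a : ℝ), Problem U P φ ψ a →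
    toEuclideanLin (Circuit.toOp U P φ Φ) (prodKet ![1, 0] φ) =
      f a • prodKet ![1, 0] φ + g a • prodKet ![1, 0] (initPerp U φ ψ a) ∧
    toEuclideanLin (Circuit.toOp U P φ Φ) (prodKet ![0, 1] φ) =
      star (f a) • prodKet ![0, 1] φ + star (g a) • prodKet ![0, 1] (initPerp U φ ψ a)

/-- The circuit maps the initial state to `f ψ + g ψ⊥` on ancilla `|0⟩`, and to the state with
conjugate amplitudes on ancilla `|1⟩`. -/
def OddReal (Φ : Circuit) (f g : ℝ → ℂ) : Prop :=
  ∀ (n : ℕ) (U P : Op n) (φ ψ : Reg n) (a : ℝ), Problem U P φ ψ a →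
    toEuclideanLin (Circuit.toOp U P φ Φ) (prodKet ![1, 0] φ) =
      f a • prodKet ![1, 0] ψ + g a • prodKet ![1, 0] (targetPerp U φ ψ a) ∧
    toEuclideanLin (Circuit.toOp U P φ Φ) (prodKet ![0, 1] φ) =
      star (f a) • prodKet ![0, 1] ψ + star (g a) • prodKet ![0, 1] (targetPerp U φ ψ a)

lemma star_exp_mul_I (t : ℝ) :
    star (Complex.exp (t * Complex.I)) = Complex.exp (-(t * Complex.I)) := by
  rw [Complex.star_def, ← Complex.exp_conj]
  simp

lemma star_exp_neg_mul_I (t : ℝ) :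
    star (Complex.exp (-(t * Complex.I))) = Complex.exp (t * Complex.I) := by
  rw [← star_exp_mul_I, star_star]

lemma star_ofReal (a : ℝ) : star (a : ℂ) = a := Complex.conj_ofReal a

lemma evenReal_phase (t : ℝ) :
    EvenReal [.cNotInit, .rotZ (2 * t), .cNotInit]
      (fun _ => Complex.exp (t * Complex.I)) (fun _ => 0) := by
  intro n U P φ ψ a h
  have hop : Circuit.toOp U P φ [.cNotInit, .rotZ (2 * t), .cNotInit] =
      phaseOp (ketBra φ) t := by
    simp only [Circuit.toOp, Gate.toOp, phaseOp, one_mul]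
  rw [hop, phaseOp_zero_of_fixed t h.ketBra_init, phaseOp_one_of_fixed t h.ketBra_init,
    star_exp_mul_I]
  simp

lemma EvenReal.oracle_phase {Φ : Circuit} {f g : ℝ → ℂ} (H : EvenReal Φ f g) (t : ℝ) :
    OddReal (Φ ++ [.oracle, .cNotTarget, .rotZ (2 * t), .cNotTarget])
      (fun a => Complex.exp (t * Complex.I) * (a * f a + (1 - a ^ 2) * g a))
      (fun a => Complex.exp (-(t * Complex.I)) * (f a - a * g a)) := by
  intro n U P φ ψ a h
  have hop : Circuit.toOp U P φ (Φ ++ [.oracle, .cNotTarget, .rotZ (2 * t), .cNotTarget]) =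
      phaseOp P t * ((1 : Matrix (Fin 2) (Fin 2) ℂ) ⊗ₖ U) * Circuit.toOp U P φ Φ := by
    simp only [Circuit.toOp_append, Circuit.toOp, Gate.toOp, phaseOp, one_mul, mul_assoc]
  have hφ : toEuclideanLin U φ = (a : ℂ) • ψ + targetPerp U φ ψ a := Problem.apply_init
  rw [hop]
  simp only [toEuclideanLin_mul_apply, (H n U P φ ψ a h).1, (H n U P φ ψ a h).2, map_add, map_smul,
    kronecker_prodKet, one_mulVec, h.apply_initPerp, hφ, sub_eq_add_neg, ← neg_smul,
    prodKet_add_right, prodKet_smul_right, phaseOp_zero_of_fixed t h.proj_target,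
    phaseOp_one_of_fixed t h.proj_target, phaseOp_zero_of_kernel t h.proj_targetPerp,
    phaseOp_one_of_kernel t h.proj_targetPerp, star_mul', star_add, star_exp_mul_I,
    star_exp_neg_mul_I, star_neg, star_one, star_pow, star_ofReal]
  constructor <;> module

lemma OddReal.oracleAdj_phase {Φ : Circuit} {f g : ℝ → ℂ} (H : OddReal Φ f g) (t : ℝ) :
    EvenReal (Φ ++ [.oracleAdj, .cNotInit, .rotZ (2 * t), .cNotInit])
      (fun a => Complex.exp (t * Complex.I) * (a * f a + (1 - a ^ 2) * g a))
      (fun a => Complex.exp (-(t * Complex.I)) * (f a - a * g a)) := by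
  intro n U P φ ψ a h
  have hop : Circuit.toOp U P φ (Φ ++ [.oracleAdj, .cNotInit, .rotZ (2 * t), .cNotInit]) =
      phaseOp (ketBra φ) t * ((1 : Matrix (Fin 2) (Fin 2) ℂ) ⊗ₖ Uᴴ) * Circuit.toOp U P φ Φ := by
    simp only [Circuit.toOp_append, Circuit.toOp, Gate.toOp, phaseOp, one_mul, mul_assoc]
  have hψ : toEuclideanLin Uᴴ ψ = (a : ℂ) • φ + initPerp U φ ψ a := Problem.adj_target
  rw [hop]
  simp only [toEuclideanLin_mul_apply, (H n U P φ ψ a h).1, (H n U P φ ψ a h).2, map_add, map_smul,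
    kronecker_prodKet, one_mulVec, h.adj_targetPerp, hψ, sub_eq_add_neg, ← neg_smul,
    prodKet_add_right, prodKet_smul_right, phaseOp_zero_of_fixed t h.ketBra_init,
    phaseOp_one_of_fixed t h.ketBra_init, phaseOp_zero_of_kernel t h.ketBra_initPerp,
    phaseOp_one_of_kernel t h.ketBra_initPerp, star_mul', star_add, star_exp_mul_I,
    star_exp_neg_mul_I, star_neg, star_one, star_pow, star_ofReal]
  constructor <;> module

end FixedPointAA

/-! ### Unitarity of circuits -/

namespace FixedPointAA

open Matrix

section unitary

variable {n : ℕ}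

lemma cNot_mem_unitaryGroup {P : Op n} (h : IsStarProjection P) :
    cNot P ∈ unitaryGroup (Fin 2 × Bits n) ℂ := by
  have hX : pauliXᴴ = pauliX := by
    ext i j; fin_cases i <;> fin_cases j <;> simp [pauliX]
  have hXX : pauliX * pauliX = 1 := by
    ext i j; fin_cases i <;> fin_cases j <;> simp [pauliX]
  have hP : Pᴴ = P := h.isSelfAdjoint
  have hPP : P * P = P := h.isIdempotentElem
  rw [mem_unitaryGroup_iff, star_eq_conjTranspose]
  have hc : (cNot P)ᴴ = cNot P := by
    rw [cNot, conjTranspose_add, conjTranspose_kronecker, conjTranspose_kronecker, hX,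
      conjTranspose_sub, hP, conjTranspose_one, conjTranspose_one]
  rw [hc, cNot, add_mul, mul_add, mul_add, ← mul_kronecker_mul, ← mul_kronecker_mul,
    ← mul_kronecker_mul, ← mul_kronecker_mul, hXX]
  simp only [mul_sub, sub_mul, hPP, mul_one, one_mul, sub_self, kronecker_zero, add_zero, zero_add,
    sub_zero]
  rw [← kronecker_add, add_sub_cancel, one_kronecker_one]

lemma rotX_mem_unitaryGroup (θ : ℝ) : rotX θ ∈ unitaryGroup (Fin 2) ℂ := by
  have h := Complex.sin_sq_add_cos_sq ((θ / 2 : ℝ) : ℂ)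
  have h' := Complex.I_sq
  rw [mem_unitaryGroup_iff]
  ext i j
  fin_cases i <;> fin_cases j <;>
    simp [rotX, mul_apply, Fin.sum_univ_two, star_apply, -Complex.ofReal_cos,
      -Complex.ofReal_sin] <;>
    push_cast at h ⊢
  · linear_combination h - Complex.sin (θ / 2) ^ 2 * h'
  · ring
  · ring
  · linear_combination h - Complex.sin (θ / 2) ^ 2 * h'

lemma rotY_mem_unitaryGroup (θ : ℝ) : rotY θ ∈ unitaryGroup (Fin 2) ℂ := by
  have h := Complex.sin_sq_add_cos_sq ((θ / 2 : ℝ) : ℂ)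
  rw [mem_unitaryGroup_iff]
  ext i j
  fin_cases i <;> fin_cases j <;>
    simp [rotY, mul_apply, Fin.sum_univ_two, star_apply, -Complex.ofReal_cos,
      -Complex.ofReal_sin] <;>
    push_cast at h ⊢
  · linear_combination h
  · ring
  · ring
  · linear_combination h

lemma rotZ_mem_unitaryGroup (θ : ℝ) : rotZ θ ∈ unitaryGroup (Fin 2) ℂ := by
  have h2 : (starRingEnd ℂ) 2 = 2 := Complex.conj_ofNat 2
  rw [mem_unitaryGroup_iff]
  ext i j
  fin_cases i <;> fin_cases j <;>
    simp [rotZ, mul_apply, Fin.sum_univ_two, star_apply, ← Complex.exp_conj, ← Complex.exp_add,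
      h2]

lemma Gate.toOp_mem_unitaryGroup {U P : Op n} {φ : Reg n} (hU : U ∈ unitaryGroup (Bits n) ℂ)
    (hP : IsStarProjection P) (hφ : ‖φ‖ = 1) (g : Gate) :
    g.toOp U P φ ∈ unitaryGroup (Fin 2 × Bits n) ℂ := by
  cases g with
  | oracle => exact kronecker_mem_unitary (one_mem _) hU
  | oracleAdj => exact kronecker_mem_unitary (one_mem _) (Unitary.star_mem hU)
  | cNotTarget => exact cNot_mem_unitaryGroup hP
  | cNotInit => exact cNot_mem_unitaryGroup (isStarProjection_ketBra hφ)
  | rotX θ => exact kronecker_mem_unitary (rotX_mem_unitaryGroup θ) (one_mem _)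
  | rotY θ => exact kronecker_mem_unitary (rotY_mem_unitaryGroup θ) (one_mem _)
  | rotZ θ => exact kronecker_mem_unitary (rotZ_mem_unitaryGroup θ) (one_mem _)

lemma Circuit.toOp_mem_unitaryGroup {U P : Op n} {φ : Reg n} (hU : U ∈ unitaryGroup (Bits n) ℂ)
    (hP : IsStarProjection P) (hφ : ‖φ‖ = 1) (c : Circuit) :
    Circuit.toOp U P φ c ∈ unitaryGroup (Fin 2 × Bits n) ℂ := by
  induction c with
  | nil => exact one_mem _
  | cons g c ih => exact mul_mem ih (g.toOp_mem_unitaryGroup hU hP hφ)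

end unitary

/-! ### Quantum signal processing: from complementary polynomials to circuits -/

section signal

open Polynomial

lemma exists_phase_eq {α β : ℂ} (h : α * star α = β * star β) :
    ∃ t : ℝ, Complex.exp (-(t * Complex.I)) * α = Complex.exp (t * Complex.I) * β := by
  have hn : ‖α‖ = ‖β‖ := by
    rw [Complex.star_def, Complex.mul_conj', Complex.mul_conj'] at h
    have h2 : ‖α‖ ^ 2 = ‖β‖ ^ 2 := by exact_mod_cast h
    exact (pow_left_inj₀ (norm_nonneg _) (norm_nonneg _) two_ne_zero).1 h2
  refine ⟨(α.arg - β.arg) / 2, ?_⟩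
  have hα := Complex.norm_mul_exp_arg_mul_I α
  have hβ := Complex.norm_mul_exp_arg_mul_I β
  generalize α.arg = u at hα ⊢
  generalize β.arg = v at hβ ⊢
  rw [← hα, ← hβ, hn, mul_left_comm, mul_left_comm _ (‖β‖ : ℂ), ← Complex.exp_add, ← Complex.exp_add]
  congr 2
  push_cast
  ring

/-- The polynomial with conjugate coefficients. -/
noncomputable def conjPoly (S : ℂ[X]) : ℂ[X] := S.map (starRingEnd ℂ)

lemma coeff_mul_conjPoly {S : ℂ[X]} {m : ℕ} (h : S.natDegree ≤ m) :
    (S * conjPoly S).coeff (m + m) = S.coeff m * star (S.coeff m) := by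
  have h' : (conjPoly S).natDegree ≤ m := natDegree_map_le.trans h
  rw [coeff_mul_add_eq_of_natDegree_le h h', conjPoly, coeff_map, starRingEnd_apply]

lemma natDegree_mul_conjPoly_le {S : ℂ[X]} {m : ℕ} (h : S.natDegree ≤ m) :
    (S * conjPoly S).natDegree ≤ m + m :=
  natDegree_mul_le_of_le h (natDegree_map_le.trans h)

lemma natDegree_X_mul_le_of_coeff_eq_zero {Q : ℂ[X]} {m : ℕ} (h : Q.natDegree ≤ m)
    (h0 : Q.coeff m = 0) : (X * Q).natDegree ≤ m := by
  rw [natDegree_le_iff_coeff_eq_zero]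
  intro k hk
  obtain ⟨j, rfl⟩ : ∃ j, k = j + 1 := ⟨k - 1, by omega⟩
  rw [coeff_X_mul]
  rcases eq_or_ne j m with rfl | hj
  · exact h0
  · exact coeff_eq_zero_of_natDegree_lt (by omega)

lemma natDegree_le_of_X_mul_le_succ {Q : ℂ[X]} {m : ℕ} (h : (X * Q).natDegree ≤ m + 1) :
    Q.natDegree ≤ m := by
  rcases eq_or_ne Q 0 with rfl | hQ
  · simp
  rw [natDegree_X_mul hQ] at h
  omega

lemma exp_mul_exp_neg (t : ℝ) :
    Complex.exp (t * Complex.I) * Complex.exp (-(t * Complex.I)) = 1 := by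
  rw [← Complex.exp_add, add_neg_cancel, Complex.exp_zero]

/-- The coefficient of `y^(2m+1)` on the left must vanish, and it is the difference of the two
sides. -/
lemma coeff_eq_of_odd {m : ℕ} {S Q : ℂ[X]} (hS : S.natDegree ≤ m) (hQ : Q.natDegree ≤ m)
    (h : X * (S * conjPoly S) + (1 - X) * (Q * conjPoly Q) = 1) :
    S.coeff m * star (S.coeff m) = Q.coeff m * star (Q.coeff m) := by
  have h1 : X * (S * conjPoly S - Q * conjPoly Q) + Q * conjPoly Q = 1 := by
    rw [← h]; ring
  have h2 := congrArg (fun p : ℂ[X] => p.coeff (m + m + 1)) h1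
  simp only [coeff_add, coeff_X_mul, coeff_sub, coeff_mul_conjPoly hS, coeff_mul_conjPoly hQ,
    coeff_one] at h2
  rw [coeff_eq_zero_of_natDegree_lt (Nat.lt_succ_of_le (natDegree_mul_conjPoly_le hQ))] at h2
  simpa [sub_eq_zero] using h2

lemma coeff_eq_of_even {m : ℕ} {S Q : ℂ[X]} (hS : S.natDegree ≤ m + 1) (hQ : Q.natDegree ≤ m)
    (h : S * conjPoly S + X * (1 - X) * (Q * conjPoly Q) = 1) :
    S.coeff (m + 1) * star (S.coeff (m + 1)) = Q.coeff m * star (Q.coeff m) := by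
  have h1 : S * conjPoly S + X * (Q * conjPoly Q) - X * (X * (Q * conjPoly Q)) = 1 := by
    rw [← h]; ring
  have h2 := congrArg (fun p : ℂ[X] => p.coeff (m + m + 1 + 1)) h1
  have h3 : m + m + 1 + 1 = (m + 1) + (m + 1) := by omega
  simp only [coeff_add, coeff_X_mul, coeff_sub, coeff_mul_conjPoly hQ, coeff_one] at h2
  rw [coeff_eq_zero_of_natDegree_lt (Nat.lt_succ_of_le (natDegree_mul_conjPoly_le hQ)), h3,
    coeff_mul_conjPoly hS] at h2
  simpa [sub_eq_zero] using h2

/-- Undo the last phase and oracle. As the oracle matrix is an involution, the amplitudes before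
them are `S' = y(w'S - wQ) + wQ` and `a Q'` with `Q' = w'S - wQ`, where `w = exp(it)` and `w' =
exp(-it)`; they are again complementary. -/
lemma exists_oddReal_of_even {m : ℕ}
    (ih : ∀ S Q : ℂ[X], S.natDegree ≤ m → (X * Q).natDegree ≤ m →
      S * conjPoly S + X * (1 - X) * (Q * conjPoly Q) = 1 →
      ∃ Φ : Circuit, Φ.length = 8 * m + 3 ∧
        EvenReal Φ (fun a => S.eval ((a : ℂ) ^ 2)) (fun a => a * Q.eval ((a : ℂ) ^ 2)))
    {S Q : ℂ[X]} (hS : S.natDegree ≤ m) (hQ : Q.natDegree ≤ m)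
    (h : X * (S * conjPoly S) + (1 - X) * (Q * conjPoly Q) = 1) :
    ∃ Φ : Circuit, Φ.length = 8 * m + 7 ∧
      OddReal Φ (fun a => a * S.eval ((a : ℂ) ^ 2)) (fun a => Q.eval ((a : ℂ) ^ 2)) := by
  obtain ⟨t, ht⟩ := exists_phase_eq (coeff_eq_of_odd hS hQ h)
  set w := Complex.exp (t * Complex.I) with hw
  set w' := Complex.exp (-(t * Complex.I)) with hw'
  have hww : w * w' = 1 := exp_mul_exp_neg t
  have hconj : star w = w' := star_exp_mul_I t
  have hconj' : star w' = w := star_exp_neg_mul_I t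
  have hCC : C w * C w' = 1 := by rw [← C_mul, hww, C_1]
  -- The angle `t` was chosen so that the coefficients of degree `m` cancel.
  have hQ' : (X * (C w' * S - C w * Q)).natDegree ≤ m := by
    apply natDegree_X_mul_le_of_coeff_eq_zero
    · exact (natDegree_sub_le_of_le ((natDegree_C_mul_le _ _).trans hS)
        ((natDegree_C_mul_le _ _).trans hQ)).trans (by simp)
    · simp [ht]
  have hS' : (X * (C w' * S - C w * Q) + C w * Q).natDegree ≤ m :=
    natDegree_add_le_of_degree_le hQ' ((natDegree_C_mul_le _ _).trans hQ)
  have hnorm : (X * (C w' * S - C w * Q) + C w * Q) * conjPoly (X * (C w' * S - C w * Q) + C w * Q)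
      + X * (1 - X) * ((C w' * S - C w * Q) * conjPoly (C w' * S - C w * Q)) = 1 := by
    simp only [conjPoly, Polynomial.map_add, Polynomial.map_sub, Polynomial.map_mul, map_X, map_C,
      starRingEnd_apply, hconj, hconj'] at h ⊢
    linear_combination h + hCC * (X * (S * map (starRingEnd ℂ) S)
      + (1 - X) * (Q * map (starRingEnd ℂ) Q))
  obtain ⟨Φ, hlen, hΦ⟩ := ih _ _ hS' hQ' hnorm
  refine ⟨Φ ++ [.oracle, .cNotTarget, .rotZ (2 * t), .cNotTarget], by simp [hlen], ?_⟩
  convert hΦ.oracle_phase t using 2 with a a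
  · simp only [eval_add, eval_sub, eval_mul, eval_X, eval_C, ← hw]
    linear_combination (-(a * eval ((a : ℂ) ^ 2) S)) * hww
  · simp only [eval_add, eval_sub, eval_mul, eval_X, eval_C, ← hw']
    linear_combination (-(eval ((a : ℂ) ^ 2) Q)) * hww

lemma exists_evenReal_succ_of_odd {m : ℕ}
    (ih : ∀ S Q : ℂ[X], S.natDegree ≤ m → Q.natDegree ≤ m →
      X * (S * conjPoly S) + (1 - X) * (Q * conjPoly Q) = 1 →
      ∃ Φ : Circuit, Φ.length = 8 * m + 7 ∧
        OddReal Φ (fun a => a * S.eval ((a : ℂ) ^ 2)) (fun a => Q.eval ((a : ℂ) ^ 2)))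
    {S Q : ℂ[X]} (hS : S.natDegree ≤ m + 1) (hQ : (X * Q).natDegree ≤ m + 1)
    (h : S * conjPoly S + X * (1 - X) * (Q * conjPoly Q) = 1) :
    ∃ Φ : Circuit, Φ.length = 8 * (m + 1) + 3 ∧
      EvenReal Φ (fun a => S.eval ((a : ℂ) ^ 2)) (fun a => a * Q.eval ((a : ℂ) ^ 2)) := by
  have hQm := natDegree_le_of_X_mul_le_succ hQ
  obtain ⟨t, ht⟩ := exists_phase_eq (coeff_eq_of_even hS hQm h)
  set w := Complex.exp (t * Complex.I) with hw
  set w' := Complex.exp (-(t * Complex.I)) with hw'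
  have hww : w * w' = 1 := exp_mul_exp_neg t
  have hconj : star w = w' := star_exp_mul_I t
  have hconj' : star w' = w := star_exp_neg_mul_I t
  have hCC : C w * C w' = 1 := by rw [← C_mul, hww, C_1]
  have hQ' : (C w' * S - C w * (X * Q)).natDegree ≤ m := by
    apply natDegree_le_of_X_mul_le_succ
    apply natDegree_X_mul_le_of_coeff_eq_zero
    · exact (natDegree_sub_le_of_le ((natDegree_C_mul_le _ _).trans hS)
        ((natDegree_C_mul_le _ _).trans hQ)).trans (by simp)
    · simp [ht]
  have hS' : (C w' * S - C w * (X * Q) + C w * Q).natDegree ≤ m :=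
    natDegree_add_le_of_degree_le hQ' ((natDegree_C_mul_le _ _).trans hQm)
  have hnorm : X * ((C w' * S - C w * (X * Q) + C w * Q) *
        conjPoly (C w' * S - C w * (X * Q) + C w * Q))
      + (1 - X) * ((C w' * S - C w * (X * Q)) * conjPoly (C w' * S - C w * (X * Q))) = 1 := by
    simp only [conjPoly, Polynomial.map_add, Polynomial.map_sub, Polynomial.map_mul, map_X, map_C,
      starRingEnd_apply, hconj, hconj'] at h ⊢
    linear_combination h + hCC * (S * map (starRingEnd ℂ) S
      + X * (1 - X) * (Q * map (starRingEnd ℂ) Q))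
  obtain ⟨Φ, hlen, hΦ⟩ := ih _ _ hS' hQ' hnorm
  refine ⟨Φ ++ [.oracleAdj, .cNotInit, .rotZ (2 * t), .cNotInit], by simp [hlen]; omega, ?_⟩
  convert hΦ.oracleAdj_phase t using 2 with a a
  · simp only [eval_add, eval_sub, eval_mul, eval_X, eval_C, ← hw]
    linear_combination (-(eval ((a : ℂ) ^ 2) S)) * hww
  · simp only [eval_add, eval_sub, eval_mul, eval_X, eval_C, ← hw']
    linear_combination (-(a * eval ((a : ℂ) ^ 2) Q)) * hww

lemma exists_evenReal (m : ℕ) : ∀ S Q : ℂ[X], S.natDegree ≤ m → (X * Q).natDegree ≤ m →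
    S * conjPoly S + X * (1 - X) * (Q * conjPoly Q) = 1 →
    ∃ Φ : Circuit, Φ.length = 8 * m + 3 ∧
      EvenReal Φ (fun a => S.eval ((a : ℂ) ^ 2)) (fun a => a * Q.eval ((a : ℂ) ^ 2)) := by
  induction m with
  | zero =>
    intro S Q hS hQ h
    obtain rfl : Q = 0 := by
      by_contra hne
      rw [natDegree_X_mul hne] at hQ
      omega
    obtain ⟨s, rfl⟩ := natDegree_eq_zero.1 (Nat.le_zero.1 hS)
    have hs : s * star s = 1 * star 1 := by
      have := congrArg (eval 0) h
      simpa [conjPoly] using this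
    obtain ⟨t, ht⟩ := exists_phase_eq hs
    -- Comparing `s` with 1 splits the phase evenly, so `t` is half the argument of `s`.
    have h2 : s = Complex.exp (((2 * t : ℝ) : ℂ) * Complex.I) := by
      have h3 : ((2 * t : ℝ) : ℂ) * Complex.I = t * Complex.I + t * Complex.I := by
        push_cast; ring
      rw [h3, Complex.exp_add]
      linear_combination (Complex.exp (t * Complex.I)) * ht - s * exp_mul_exp_neg t
    refine ⟨[.cNotInit, .rotZ (2 * (2 * t)), .cNotInit], rfl, ?_⟩
    simpa [h2] using evenReal_phase (2 * t)
  | succ m ih =>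
    intro S Q hS hQ h
    exact exists_evenReal_succ_of_odd (fun S Q hS hQ h => exists_oddReal_of_even ih hS hQ h) hS hQ h

/-- **Quantum signal processing**: complementary polynomials are the amplitudes of a circuit. -/
theorem exists_oddReal (m : ℕ) {S Q : ℂ[X]} (hS : S.natDegree ≤ m) (hQ : Q.natDegree ≤ m)
    (h : X * (S * conjPoly S) + (1 - X) * (Q * conjPoly Q) = 1) :
    ∃ Φ : Circuit, Φ.length = 8 * m + 7 ∧
      OddReal Φ (fun a => a * S.eval ((a : ℂ) ^ 2)) (fun a => Q.eval ((a : ℂ) ^ 2)) :=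
  exists_oddReal_of_even (exists_evenReal m) hS hQ h

/-- A real odd polynomial `x p(x²)` of modulus less than one on `[0, 1]` is the real part of an
amplitude. -/
theorem exists_oddReal_re (N : ℕ) {p : ℝ[X]} (hp : p.natDegree ≤ N)
    (hlt : ∀ y ∈ Set.Icc (0 : ℝ) 1, y * p.eval y ^ 2 < 1) :
    ∃ (Φ : Circuit) (f g : ℝ → ℂ), Φ.length = 8 * N + 7 ∧ OddReal Φ f g ∧
      ∀ a : ℝ, (f a).re = a * p.eval (a ^ 2) := by
  have hdeg : (1 - X * p ^ 2).natDegree ≤ 2 * N + 1 := by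
    refine (natDegree_sub_le_of_le (m := 2 * N + 1) (n := 2 * N + 1) (by simp) ?_).trans (by simp)
    rw [add_comm]
    exact natDegree_mul_le_of_le natDegree_X_le (natDegree_pow_le_of_le 2 hp)
  obtain ⟨s, q, hs, hq, hsq⟩ := oddForm_of_pos hdeg (fun y hy => by simpa using hlt y hy)
  have hcm : ∀ r : ℝ[X],
      (r.map Complex.ofRealHom).map (starRingEnd ℂ) = r.map Complex.ofRealHom := by
    intro r
    rw [Polynomial.map_map]
    congr 1
    ext x
    simp
  -- The pair is `S = p + is` and `Q = q`: on real arguments `|S|² = p² + s²`, so the Lukács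
  -- decomposition of `1 - y p²` is exactly complementarity.
  have hS : (p.map Complex.ofRealHom + C Complex.I * s.map Complex.ofRealHom).natDegree ≤ N :=
    natDegree_add_le_of_degree_le (natDegree_map_le.trans hp)
      ((natDegree_C_mul_le _ _).trans (natDegree_map_le.trans hs))
  have hQ : (q.map Complex.ofRealHom).natDegree ≤ N := natDegree_map_le.trans hq
  obtain ⟨Φ, hlen, hΦ⟩ := exists_oddReal N hS hQ (by
    have h1 := congrArg (Polynomial.map Complex.ofRealHom) hsq
    have hI : (C Complex.I : ℂ[X]) ^ 2 = -1 := by rw [← C_pow, Complex.I_sq]; simp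
    simp only [Polynomial.map_add, Polynomial.map_sub, Polynomial.map_mul, Polynomial.map_pow,
      Polynomial.map_one, map_X] at h1
    simp only [conjPoly, Polynomial.map_add, Polynomial.map_mul, hcm, map_C, Complex.conj_I, C_neg]
    linear_combination -h1 - X * (s.map Complex.ofRealHom) ^ 2 * hI)
  refine ⟨Φ, _, _, hlen, hΦ, fun a => ?_⟩
  have he : ∀ r : ℝ[X],
      (r.map Complex.ofRealHom).eval ((a : ℂ) ^ 2) = ((r.eval (a ^ 2) : ℝ) : ℂ) := by
    intro r
    have := eval_map_apply (f := Complex.ofRealHom) (p := r) (a ^ 2)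
    simpa using this
  simp [he]

end signal

/-! ### Extracting the real part with the ancilla in `|+⟩` -/

section realPart

variable {n : ℕ}

lemma inner_prodKet (w w' : Fin 2 → ℂ) (v v' : Reg n) :
    (inner ℂ (prodKet w v) (prodKet w' v') : ℂ) = (star w ⬝ᵥ w') * inner ℂ v v' := by
  simp only [PiLp.inner_apply, prodKet, RCLike.inner_apply, dotProduct, Fintype.sum_prod_type,
    Finset.sum_mul_sum, Pi.star_apply]
  refine Finset.sum_congr rfl fun _ _ => Finset.sum_congr rfl fun _ _ => ?_
  simp only [map_mul, starRingEnd_apply]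
  ring

/-- The circuit `Φ` with the ancilla prepared and measured in the state `|+⟩`. -/
noncomputable def plusCircuit (Φ : Circuit) : Circuit :=
  .rotY (Real.pi / 2) :: (Φ ++ [.rotY (-(Real.pi / 2))])

lemma rotY_mulVec_zero : rotY (Real.pi / 2) *ᵥ ![1, 0] =
    ((√2 / 2 : ℝ) : ℂ) • ![1, 0] + ((√2 / 2 : ℝ) : ℂ) • ![0, 1] := by
  have h : Real.pi / 2 / 2 = Real.pi / 4 := by ring
  ext i
  fin_cases i <;> simp [rotY, mulVec, dotProduct, h, - Complex.ofReal_cos, - Complex.ofReal_sin]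

/-- The final rotation is the adjoint of the first, so the overlap is taken between `|+⟩|ψ⟩` and the
image of `|+⟩|φ⟩`. It averages `f a` and its conjugate, and `ψ⊥` drops out by orthogonality. -/
lemma inner_plusCircuit {Φ : Circuit} {f g : ℝ → ℂ} (H : OddReal Φ f g) {U P : Op n}
    {φ ψ : Reg n} {a : ℝ} (h : Problem U P φ ψ a) :
    (inner ℂ (ketZero ψ)
      (toEuclideanLin (Circuit.toOp U P φ (plusCircuit Φ)) (ketZero φ)) : ℂ) = (f a).re := by
  have hadj : (rotY (-(Real.pi / 2)) ⊗ₖ (1 : Op n))ᴴ = rotY (Real.pi / 2) ⊗ₖ (1 : Op n) := by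
    rw [conjTranspose_kronecker, conjTranspose_one]
    congr 1
    ext i j
    fin_cases i <;> fin_cases j <;> simp [rotY, neg_div, -Complex.ofReal_cos, -Complex.ofReal_sin]
  have hop : Circuit.toOp U P φ (plusCircuit Φ) = (rotY (-(Real.pi / 2)) ⊗ₖ (1 : Op n)) *
      Circuit.toOp U P φ Φ * (rotY (Real.pi / 2) ⊗ₖ (1 : Op n)) := by
    simp only [plusCircuit, Circuit.toOp, Circuit.toOp_append, Gate.toOp, one_mul]
  have h2 : (√2 / 2 : ℝ) * (√2 / 2) = 1 / 2 := by
    have := Real.mul_self_sqrt (zero_le_two (α := ℝ))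
    linarith
  have h2c : ((√2 / 2 : ℝ) : ℂ) * ((√2 / 2 : ℝ) : ℂ) = 1 / 2 := by
    rw [← Complex.ofReal_mul, h2]
    norm_num
  have hψ : (inner ℂ ψ ψ : ℂ) = 1 := by
    rw [inner_self_eq_norm_sq_to_K, h.norm_target]; simp
  rw [hop, toEuclideanLin_mul_apply, toEuclideanLin_mul_apply, ← conjTranspose_conjTranspose
    (rotY (-(Real.pi / 2)) ⊗ₖ (1 : Op n)), ← inner_toEuclideanLin_left, hadj, ketZero_eq_prodKet,
    ketZero_eq_prodKet, kronecker_prodKet, kronecker_prodKet, rotY_mulVec_zero, toLpLin_one]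
  simp only [LinearMap.id_apply, prodKet_add_left, prodKet_smul_left, map_add, map_smul,
    (H n U P φ ψ a h).1, (H n U P φ ψ a h).2, inner_add_left, inner_add_right, inner_smul_left,
    inner_smul_right, inner_prodKet, h.inner_target_targetPerp, hψ]
  have hre : ((f a).re : ℂ) = (f a + (starRingEnd ℂ) (f a)) / 2 := Complex.re_eq_add_conj _
  rw [hre]
  simp [dotProduct, -Complex.ofReal_div]
  linear_combination (f a + (starRingEnd ℂ) (f a)) * h2c

lemma norm_toEuclideanLin_of_mem_unitaryGroup {ι : Type*} [Fintype ι] [DecidableEq ι]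
    {A : Matrix ι ι ℂ} (hA : A ∈ unitaryGroup ι ℂ) (v : EuclideanSpace ℂ ι) :
    ‖toEuclideanLin A v‖ = ‖v‖ := by
  have h : (inner ℂ (toEuclideanLin A v) (toEuclideanLin A v) : ℂ) = inner ℂ v v := by
    rw [inner_toEuclideanLin_left, ← toEuclideanLin_mul_apply, ← star_eq_conjTranspose,
      mem_unitaryGroup_iff'.1 hA]
    simp
  rw [inner_self_eq_norm_sq_to_K, inner_self_eq_norm_sq_to_K] at h
  have h' : ‖toEuclideanLin A v‖ ^ 2 = ‖v‖ ^ 2 := by exact_mod_cast h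
  exact (pow_left_inj₀ (norm_nonneg _) (norm_nonneg _) two_ne_zero).1 h'

lemma norm_ketZero (v : Reg n) : ‖ketZero v‖ = ‖v‖ := by
  have h : (inner ℂ (ketZero v) (ketZero v) : ℂ) = inner ℂ v v := by
    rw [ketZero_eq_prodKet, inner_prodKet]
    simp [dotProduct]
  rw [inner_self_eq_norm_sq_to_K, inner_self_eq_norm_sq_to_K] at h
  have h' : ‖ketZero v‖ ^ 2 = ‖v‖ ^ 2 := by exact_mod_cast h
  exact (pow_left_inj₀ (norm_nonneg _) (norm_nonneg _) two_ne_zero).1 h'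

lemma norm_sub_plusCircuit_sq {Φ : Circuit} {f g : ℝ → ℂ} (H : OddReal Φ f g) {U P : Op n}
    {φ ψ : Reg n} {a : ℝ} (h : Problem U P φ ψ a) :
    ‖ketZero ψ - toEuclideanLin (Circuit.toOp U P φ (plusCircuit Φ)) (ketZero φ)‖ ^ 2 =
      2 - 2 * (f a).re := by
  have hU := Circuit.toOp_mem_unitaryGroup h.unitary h.proj h.norm_init (plusCircuit Φ)
  rw [norm_sub_sq (𝕜 := ℂ), inner_plusCircuit H h, norm_toEuclideanLin_of_mem_unitaryGroup hU,
    norm_ketZero, norm_ketZero, h.norm_init, h.norm_target]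
  simp
  ring

end realPart

end FixedPointAA

/-! ### Bounded odd polynomials close to 1 away from the origin -/

namespace FixedPointAA

section approximation

open Polynomial

lemma exists_odd_antideriv (q : ℝ[X]) : ∃ r : ℝ[X], r.natDegree ≤ q.natDegree ∧
    ∀ x : ℝ, HasDerivAt (fun x => x * r.eval (x ^ 2)) (q.eval (x ^ 2)) x := by
  refine ⟨∑ j ∈ Finset.range (q.natDegree + 1), C (q.coeff j / (2 * j + 1)) * X ^ j, ?_, ?_⟩
  · refine natDegree_sum_le_of_forall_le _ _ fun j hj => ?_
    exact (natDegree_C_mul_X_pow_le _ _).trans (by simpa [Nat.lt_succ_iff] using hj)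
  · intro x
    have h1 : (fun x : ℝ => x * (∑ j ∈ Finset.range (q.natDegree + 1),
        C (q.coeff j / (2 * j + 1)) * X ^ j : ℝ[X]).eval (x ^ 2)) =
        fun x => ∑ j ∈ Finset.range (q.natDegree + 1),
          q.coeff j / (2 * j + 1) * x ^ (2 * j + 1) := by
      funext x
      simp only [eval_finsetSum, eval_mul, eval_C, eval_pow, eval_X, Finset.mul_sum]
      exact Finset.sum_congr rfl fun j _ => by ring
    rw [h1, eval_eq_sum_range]
    refine HasDerivAt.fun_sum fun j _ => ?_
    refine ((hasDerivAt_pow (2 * j + 1) x).const_mul _).congr_deriv ?_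
    have : (2 * (j : ℝ) + 1) ≠ 0 := by positivity
    rw [Nat.add_sub_cancel]
    push_cast
    field_simp
    rw [pow_mul]

/-- An odd polynomial, increasing from `0` to `1` on `[0, 1]`, whose derivative is concentrated
near the origin. -/
lemma exists_step_poly (q : ℝ[X]) (hq : ∀ t ∈ Set.Icc (0 : ℝ) 1, 0 ≤ q.eval (t ^ 2))
    {c x₀ l : ℝ} (hc : 0 < c) (hcx : c ≤ x₀) (hx₀ : x₀ ≤ 1) (hl : 0 < l)
    (hlow : ∀ t ∈ Set.Ioo 0 c, l ≤ q.eval (t ^ 2)) {w w' : ℝ → ℝ}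
    (hw : ∀ t ∈ Set.Icc x₀ 1, HasDerivAt w (w' t) t)
    (hup : ∀ t ∈ Set.Icc x₀ 1, q.eval (t ^ 2) ≤ w' t) :
    ∃ r : ℝ[X], r.natDegree ≤ q.natDegree ∧
      (∀ x ∈ Set.Icc (0 : ℝ) 1, 0 ≤ x * r.eval (x ^ 2) ∧ x * r.eval (x ^ 2) ≤ 1) ∧
      ∀ x ∈ Set.Icc x₀ 1, 1 - (w 1 - w x₀) / (l * c) ≤ x * r.eval (x ^ 2) := by
  obtain ⟨r, hr, hder⟩ := exists_odd_antideriv q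
  set F : ℝ → ℝ := fun x => x * r.eval (x ^ 2) with hF
  have hFc : Continuous F := by fun_prop
  have hFd : Differentiable ℝ F := fun x => (hder x).differentiableAt
  have hmono : MonotoneOn F (Set.Icc 0 1) := by
    refine monotoneOn_of_deriv_nonneg (convex_Icc 0 1) hFc.continuousOn hFd.differentiableOn ?_
    intro x hx
    rw [(hder x).deriv]
    exact hq x (interior_subset hx)
  have hF0 : F 0 = 0 := by simp [hF]
  have hlc : l * c ≤ F c := by
    have := Convex.mul_sub_le_image_sub_of_le_deriv (convex_Icc 0 c) hFc.continuousOn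
      hFd.differentiableOn (C := l) (fun x hx => by
        rw [(hder x).deriv]
        exact hlow x (by rwa [interior_Icc] at hx)) 0 (by simp [hc.le]) c (by simp [hc.le]) hc.le
    simpa [hF0] using this
  have hF1 : l * c ≤ F 1 :=
    hlc.trans (hmono ⟨hc.le, hcx.trans hx₀⟩ (by simp) (hcx.trans hx₀))
  have hlc0 : 0 < l * c := by positivity
  have hF1pos : 0 < F 1 := hlc0.trans_le hF1
  -- The mass on `[x₀, 1]` is at most the increment of `w`. Dividing by the total mass `F 1 ≥ l c`
  -- normalises the polynomial and bounds its deficit.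
  have htail : F 1 - F x₀ ≤ w 1 - w x₀ := by
    have hanti : MonotoneOn (fun t => w t - F t) (Set.Icc x₀ 1) := by
      have hd : ∀ t ∈ Set.Icc x₀ 1, HasDerivAt (fun t => w t - F t) (w' t - q.eval (t ^ 2)) t :=
        fun t ht => (hw t ht).sub (hder t)
      refine monotoneOn_of_deriv_nonneg (convex_Icc _ _)
        (fun t ht => (hd t ht).continuousAt.continuousWithinAt)
        (fun t ht => (hd t (interior_subset ht)).differentiableAt.differentiableWithinAt) ?_
      intro t ht
      rw [(hd t (interior_subset ht)).deriv]
      exact sub_nonneg.2 (hup t (interior_subset ht))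
    have := hanti (Set.left_mem_Icc.2 hx₀) (Set.right_mem_Icc.2 hx₀) hx₀
    simp only at this
    linarith
  have heval : ∀ x, x * (C (F 1)⁻¹ * r).eval (x ^ 2) = F x / F 1 := by
    intro x
    simp only [eval_mul, eval_C, hF]
    ring
  refine ⟨C (F 1)⁻¹ * r, (natDegree_C_mul_le _ _).trans hr, fun x hx => ?_, fun x hx => ?_⟩
  · rw [heval]
    have h0 : 0 ≤ F x := hF0 ▸ hmono (by simp) hx hx.1
    exact ⟨div_nonneg h0 hF1pos.le, (div_le_one hF1pos).2 (hmono hx (by simp) hx.2)⟩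
  · rw [heval, sub_le_comm]
    have h1 : 1 - F x / F 1 = (F 1 - F x) / F 1 := by field_simp
    have h2 : F x₀ ≤ F x := hmono ⟨hc.le.trans hcx, hx₀⟩ ⟨(hc.le.trans hcx).trans hx.1, hx.2⟩ hx.1
    have h3 : F x₀ ≤ F 1 := hmono ⟨hc.le.trans hcx, hx₀⟩ (by simp) hx₀
    rw [h1]
    exact div_le_div₀ (by linarith) (by linarith) hlc0 hF1

/-- An odd polynomial mapping `[1/2, 1]` close to `1`. -/
lemma exists_poly_of_half (k : ℕ) : ∃ r : ℝ[X], r.natDegree ≤ k ∧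
    (∀ x ∈ Set.Icc (0 : ℝ) 1, 0 ≤ x * r.eval (x ^ 2) ∧ x * r.eval (x ^ 2) ≤ 1) ∧
    ∀ x ∈ Set.Icc (1 / 2 : ℝ) 1, 1 - 2 * (4 / 5 : ℝ) ^ k ≤ x * r.eval (x ^ 2) := by
  have hev : ∀ t : ℝ, ((1 - X) ^ k : ℝ[X]).eval (t ^ 2) = (1 - t ^ 2) ^ k := by
    intro t; simp
  -- The density `(1 - t²)^k` is at least `(15/16)^k` on `(0, 1/4)` and at most `(3/4)^k` on `[1/2,
  -- 1]`; the ratio of the bases is `4/5`, and that of the interval lengths is 2.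
  obtain ⟨r, hr, h01, hhalf⟩ := exists_step_poly ((1 - X) ^ k)
    (fun t ht => by
      rw [hev]
      exact pow_nonneg (by nlinarith [ht.1, ht.2]) k)
    (c := 1 / 4) (x₀ := 1 / 2) (l := (15 / 16) ^ k) (by norm_num) (by norm_num) (by norm_num)
    (by positivity)
    (fun t ht => by
      rw [hev]
      exact pow_le_pow_left₀ (by norm_num) (by nlinarith [ht.1, ht.2]) k)
    (w := fun t => (3 / 4 : ℝ) ^ k * t) (w' := fun _ => (3 / 4) ^ k)
    (fun t _ => by simpa using (hasDerivAt_id t).const_mul ((3 / 4 : ℝ) ^ k))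
    (fun t ht => by
      rw [hev]
      exact pow_le_pow_left₀ (by nlinarith [ht.1, ht.2]) (by nlinarith [ht.1, ht.2]) k)
  refine ⟨r, hr.trans ?_, h01, ?_⟩
  · have h1 : (1 - X : ℝ[X]).natDegree ≤ 1 := by compute_degree
    simpa using natDegree_pow_le_of_le k h1
  · have h2 : ((3 / 4 : ℝ) ^ k * 1 - (3 / 4) ^ k * (1 / 2)) / ((15 / 16) ^ k * (1 / 4)) =
        2 * (4 / 5) ^ k := by
      have h3 : (3 / 4 : ℝ) ^ k = (15 / 16) ^ k * (4 / 5) ^ k := by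
        rw [← mul_pow]; norm_num
      rw [h3]
      field_simp
      norm_num
    simpa only [h2] using hhalf

/-- The polynomials with `sin θ * dirichletPoly m (sin² θ) = sin ((2 m + 1) θ)`. -/
noncomputable def dirichletPoly : ℕ → ℝ[X]
  | 0 => 1
  | 1 => C 3 - C 4 * X
  | m + 2 => (C 2 - C 4 * X) * dirichletPoly (m + 1) - dirichletPoly m

lemma natDegree_dirichletPoly_le (m : ℕ) : (dirichletPoly m).natDegree ≤ m := by
  induction m using Nat.twoStepInduction with
  | zero => simp [dirichletPoly]
  | one => rw [dirichletPoly]; compute_degree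
  | more m ih0 ih1 =>
    rw [dirichletPoly]
    have h1 : (C 2 - C 4 * X : ℝ[X]).natDegree ≤ 1 := by compute_degree
    have h2 := natDegree_mul_le_of_le h1 ih1
    refine (natDegree_sub_le_of_le h2 ih0).trans ?_
    simp only [sup_le_iff]
    omega

lemma sin_mul_eval_dirichletPoly (θ : ℝ) (m : ℕ) :
    Real.sin θ * (dirichletPoly m).eval (Real.sin θ ^ 2) = Real.sin ((2 * m + 1) * θ) := by
  induction m using Nat.twoStepInduction with
  | zero => simp [dirichletPoly]
  | one =>
    have h : (2 * ((1 : ℕ) : ℝ) + 1) * θ = 3 * θ := by push_cast; ring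
    rw [h, Real.sin_three_mul]
    simp [dirichletPoly]
    ring
  | more m ih0 ih1 =>
    have h1 : (2 * ((m + 2 : ℕ) : ℝ) + 1) * θ = (2 * ((m + 1 : ℕ) : ℝ) + 1) * θ + 2 * θ := by
      push_cast; ring
    have h0 : (2 * (m : ℝ) + 1) * θ = (2 * ((m + 1 : ℕ) : ℝ) + 1) * θ - 2 * θ := by
      push_cast; ring
    rw [h0, Real.sin_sub, Real.cos_two_mul'] at ih0
    rw [h1, Real.sin_add, Real.cos_two_mul']
    have hc := Real.sin_sq_add_cos_sq θ
    simp only [dirichletPoly, eval_sub, eval_mul, eval_C, eval_X]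
    linear_combination (2 - 4 * Real.sin θ ^ 2) * ih1 - ih0
      - 2 * Real.sin ((2 * ((m + 1 : ℕ) : ℝ) + 1) * θ) * hc

/-- An odd polynomial of degree `O(1/δ)` mapping `[δ, 1]` into `[1/2, 1]`. -/
lemma exists_poly_of_gap {δ : ℝ} (hδ : 0 < δ) (hδ1 : δ ≤ 1) {m : ℕ} (hm : 5 / δ ≤ 2 * m + 1) :
    ∃ r : ℝ[X], r.natDegree ≤ 2 * m ∧
      (∀ x ∈ Set.Icc (0 : ℝ) 1, 0 ≤ x * r.eval (x ^ 2) ∧ x * r.eval (x ^ 2) ≤ 1) ∧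
      ∀ x ∈ Set.Icc δ 1, 1 / 2 ≤ x * r.eval (x ^ 2) := by
  set M : ℝ := 2 * m + 1 with hM
  have hM0 : 0 < M := by positivity
  have hMδ : 5 ≤ M * δ := (div_le_iff₀ hδ).1 hm
  have hev : ∀ t : ℝ, (dirichletPoly m ^ 2).eval (t ^ 2) = (dirichletPoly m).eval (t ^ 2) ^ 2 :=
    fun t => by simp
  have hsin : ∀ t ∈ Set.Icc (0 : ℝ) 1,
      t * (dirichletPoly m).eval (t ^ 2) = Real.sin (M * Real.arcsin t) := by
    intro t ht
    have := sin_mul_eval_dirichletPoly (Real.arcsin t) m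
    rwa [Real.sin_arcsin (by linarith [ht.1]) ht.2] at this
  have hcδ : 1 / M ≤ δ := by
    rw [div_le_iff₀ hM0]; linarith
  -- With `t = sin θ` the density is `(sin Mθ / sin θ)²`. Jordan's inequality bounds it below by
  -- `(2M/π)² ≥ 2M²/5` for `t < 1/M`, giving mass at least `2M/5`. It never exceeds `1/t²`, so the
  -- tail beyond `δ` is at most `1/δ - 1 ≤ M/5`, half of that mass.
  obtain ⟨r, hr, h01, hgap⟩ := exists_step_poly (dirichletPoly m ^ 2)
    (fun t _ => by rw [hev]; positivity)
    (c := 1 / M) (x₀ := δ) (l := 2 / 5 * M ^ 2) (by positivity) hcδ hδ1 (by positivity)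
    (fun t ht => by
      have ht1 : t ∈ Set.Icc (0 : ℝ) 1 := ⟨ht.1.le, ht.2.le.trans (hcδ.trans hδ1)⟩
      have hsint : Real.sin (Real.arcsin t) = t := Real.sin_arcsin (by linarith [ht.1]) ht1.2
      have hθ0 : 0 ≤ Real.arcsin t := Real.arcsin_nonneg.2 ht.1.le
      have hθ1 : t ≤ Real.arcsin t := by
        simpa [hsint] using Real.sin_le hθ0
      have hθ2 : 2 / Real.pi * Real.arcsin t ≤ t := by
        simpa [hsint] using Real.mul_le_sin hθ0 (Real.arcsin_le_pi_div_two t)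
      have hMt : M * t ≤ 1 := by
        have := (lt_div_iff₀ hM0).1 ht.2
        linarith
      have hMθ : M * Real.arcsin t ≤ Real.pi / 2 := by
        have h1 : Real.arcsin t ≤ Real.pi / 2 * t := by
          have h2 : Real.arcsin t = Real.pi / 2 * (2 / Real.pi * Real.arcsin t) := by
            field_simp
          rw [h2]
          exact mul_le_mul_of_nonneg_left hθ2 (by positivity)
        calc M * Real.arcsin t ≤ M * (Real.pi / 2 * t) := mul_le_mul_of_nonneg_left h1 hM0.le
          _ = Real.pi / 2 * (M * t) := by ring
          _ ≤ Real.pi / 2 * 1 := mul_le_mul_of_nonneg_left hMt (by positivity)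
          _ = Real.pi / 2 := mul_one _
      have hD : 2 / Real.pi * M ≤ (dirichletPoly m).eval (t ^ 2) := by
        have h1 := Real.mul_le_sin (mul_nonneg hM0.le hθ0) hMθ
        rw [← hsin t ht1] at h1
        have h2 : t * (2 / Real.pi * M) ≤ 2 / Real.pi * (M * Real.arcsin t) := by
          calc t * (2 / Real.pi * M) = 2 / Real.pi * (M * t) := by ring
            _ ≤ _ := by gcongr
        exact le_of_mul_le_mul_left (h2.trans h1) ht.1
      rw [hev]
      calc 2 / 5 * M ^ 2 ≤ (2 / Real.pi * M) ^ 2 := by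
            rw [mul_pow]
            gcongr
            rw [div_pow, div_le_div_iff₀ (by norm_num) (by positivity)]
            nlinarith [Real.pi_lt_d2, Real.pi_pos]
        _ ≤ _ := pow_le_pow_left₀ (by positivity) hD 2)
    (w := fun t => -t⁻¹) (w' := fun t => (t ^ 2)⁻¹)
    (fun t ht => by
      have ht0 : t ≠ 0 := (hδ.trans_le ht.1).ne'
      simpa using (hasDerivAt_inv ht0).fun_neg)
    (fun t ht => by
      have ht0 : 0 < t := hδ.trans_le ht.1
      have h1 := hsin t ⟨ht0.le, ht.2⟩
      rw [hev, ← mul_le_mul_iff_right₀ (by positivity : 0 < t ^ 2), ← mul_pow, h1,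
        mul_inv_cancel₀ (by positivity)]
      exact Real.sin_sq_le_one _)
  refine ⟨r, hr.trans ?_, h01, fun x hx => le_trans ?_ (hgap x hx)⟩
  · exact natDegree_pow_le_of_le 2 (natDegree_dirichletPoly_le m)
  · have h2 : (-(1 : ℝ)⁻¹ - -δ⁻¹) / (2 / 5 * M ^ 2 * (1 / M)) ≤ 1 / 2 := by
      rw [div_le_iff₀ (by positivity)]
      have h3 : 1 / 2 * (2 / 5 * M ^ 2 * (1 / M)) = M / 5 := by field_simp
      rw [h3]
      have h4 : δ⁻¹ ≤ M / 5 := by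
        rw [inv_le_iff_one_le_mul₀ hδ]; linarith
      norm_num
      linarith
    linarith

/-- A bounded odd polynomial `x p(x²)` that is close to `1` on `[δ, 1]`. -/
lemma exists_amplifying_poly {δ κ : ℝ} (hδ : 0 < δ) (hδ1 : δ ≤ 1) (hκ0 : 0 ≤ κ) (hκ : κ < 1)
    {m : ℕ} (hm : 5 / δ ≤ 2 * m + 1) (k : ℕ) :
    ∃ p : ℝ[X], p.natDegree ≤ 2 * m + k * (4 * m + 1) ∧
      (∀ y ∈ Set.Icc (0 : ℝ) 1, y * p.eval y ^ 2 < 1) ∧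
      ∀ x ∈ Set.Icc δ 1, κ * (1 - 2 * (4 / 5 : ℝ) ^ k) ≤ x * p.eval (x ^ 2) := by
  obtain ⟨r, hr, hr01, hrgap⟩ := exists_poly_of_gap hδ hδ1 hm
  obtain ⟨s, hs, hs01, hshalf⟩ := exists_poly_of_half k
  have heval : ∀ x : ℝ, x * (C κ * (r * s.comp (X * r ^ 2))).eval (x ^ 2) =
      κ * (x * r.eval (x ^ 2) * s.eval ((x * r.eval (x ^ 2)) ^ 2)) := by
    intro x
    simp only [eval_mul, eval_C, eval_comp, eval_X, eval_pow]
    rw [mul_pow]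
    ring
  -- This is `κ` times the composite of the two odd polynomials, written in `y = x²`. The factor `κ
  -- < 1` makes the bound strict, as strict positivity in Lukács' theorem requires.
  refine ⟨C κ * (r * s.comp (X * r ^ 2)), ?_, fun y hy => ?_, fun x hx => ?_⟩
  · refine (natDegree_C_mul_le _ _).trans (natDegree_mul_le_of_le hr ?_)
    refine natDegree_comp_le.trans (Nat.mul_le_mul hs ?_)
    have := natDegree_mul_le_of_le (natDegree_X_le (R := ℝ)) (natDegree_pow_le_of_le 2 hr)
    omega
  · have hx : √y ∈ Set.Icc (0 : ℝ) 1 := ⟨Real.sqrt_nonneg y, Real.sqrt_le_one.2 hy.2⟩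
    have h1 := heval √y
    have h2 := hs01 _ (hr01 _ hx)
    have h3 : y * (C κ * (r * s.comp (X * r ^ 2))).eval y ^ 2 =
        (√y * (C κ * (r * s.comp (X * r ^ 2))).eval (√y ^ 2)) ^ 2 := by
      rw [mul_pow, Real.sq_sqrt hy.1]
    rw [h3, h1, sq_lt_one_iff₀ (mul_nonneg hκ0 h2.1)]
    nlinarith [h2.1, h2.2]
  · rw [heval]
    have hx01 := hr01 x ⟨hδ.le.trans hx.1, hx.2⟩
    exact mul_le_mul_of_nonneg_left (hshalf _ ⟨hrgap x hx, hx01.2⟩) hκ0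

end approximation

end FixedPointAA

/-! ### Choice of parameters and circuit length -/

namespace FixedPointAA

/-- A fixed-point amplification circuit, with its length in terms of the two orders. -/
lemma exists_circuit {δ ε : ℝ} (hδ : 0 < δ) (hδ1 : δ ≤ 1) (hε : 0 < ε) (hε1 : ε < 1) {m k : ℕ}
    (hm : 5 / δ ≤ 2 * m + 1) (hk : 2 * (4 / 5 : ℝ) ^ k ≤ ε ^ 2 / 4) :
    ∃ Φ : Circuit, Φ.length = 8 * (2 * m + k * (4 * m + 1)) + 9 ∧
      ∀ (n : ℕ) (U P : Op n) (φ ψ : Reg n) (a : ℝ), Problem U P φ ψ a → δ < a →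
        ‖ketZero ψ - Matrix.toEuclideanLin (Circuit.toOp U P φ Φ) (ketZero φ)‖ ≤ ε := by
  have hε2 : ε ^ 2 < 1 := by nlinarith
  have hε0 : 0 < ε ^ 2 := by positivity
  -- The scaling and the approximation each lose `ε²/4`, so the overlap is at least `(1 - ε²/4)² ≥ 1
  -- - ε²/2` and the squared error `2 - 2 Re f` is at most `ε²`.
  obtain ⟨p, hdeg, hlt, hclose⟩ := exists_amplifying_poly hδ hδ1 (κ := 1 - ε ^ 2 / 4)
    (by linarith) (by linarith) hm k
  obtain ⟨Φ, f, g, hlen, hΦ, hf⟩ := exists_oddReal_re _ hdeg hlt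
  refine ⟨plusCircuit Φ, by simp [plusCircuit, hlen], fun n U P φ ψ a h ha => ?_⟩
  have h1 := norm_sub_plusCircuit_sq hΦ h
  have h2 := hclose a ⟨ha.le, h.amplitude_le_one⟩
  rw [hf] at h1
  have h3 : (1 - ε ^ 2 / 4) * (1 - ε ^ 2 / 4) ≤
      (1 - ε ^ 2 / 4) * (1 - 2 * (4 / 5 : ℝ) ^ k) :=
    mul_le_mul_of_nonneg_left (by linarith) (by linarith)
  refine le_of_sq_le_sq ?_ hε.le
  rw [h1]
  nlinarith

/-- `O(log (1/ε))` is a sufficient order for the second amplification step. -/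
lemma exists_order_bound {ε₀ : ℝ} (hε₀ : ε₀ < 1) :
    ∃ K : ℝ, 0 < K ∧ ∀ ε : ℝ, 0 < ε → ε ≤ ε₀ → ∃ k : ℕ,
      2 * (4 / 5 : ℝ) ^ k ≤ ε ^ 2 / 4 ∧ (k : ℝ) + 1 ≤ K * Real.log (1 / ε) := by
  rcases le_or_gt ε₀ 0 with h0 | h0
  · exact ⟨1, one_pos, fun ε h1 h2 => absurd (h1.trans_le h2) (not_lt.2 h0)⟩
  have hL0 : 0 < Real.log (1 / ε₀) := Real.log_pos (by rw [one_lt_div h0]; exact hε₀)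
  have hb : 0 < Real.log (5 / 4) := Real.log_pos (by norm_num)
  have h8 : 0 < Real.log 8 := Real.log_pos (by norm_num)
  set c := Real.log 8 / Real.log (5 / 4) + 2 with hc
  have hcpos : 0 < c := by positivity
  -- Additive constants are absorbed through `log(1/ε) ≥ log(1/ε₀) > 0`; this is where `ε₀ < 1`
  -- enters.
  refine ⟨2 / Real.log (5 / 4) + c / Real.log (1 / ε₀), by positivity, fun ε hε hεle => ?_⟩
  set L := Real.log (1 / ε) with hL
  have hLL : Real.log (1 / ε₀) ≤ L := Real.log_le_log (by positivity) (by gcongr)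
  have hLpos : 0 < L := hL0.trans_le hLL
  refine ⟨⌈(Real.log 8 + 2 * L) / Real.log (5 / 4)⌉₊, ?_, ?_⟩
  · set k := ⌈(Real.log 8 + 2 * L) / Real.log (5 / 4)⌉₊
    have hk : Real.log 8 + 2 * L ≤ k * Real.log (5 / 4) := (div_le_iff₀ hb).1 (Nat.le_ceil _)
    have h1 : Real.log (8 * (1 / ε) ^ 2) ≤ Real.log ((5 / 4) ^ k) := by
      rw [Real.log_mul (by norm_num) (by positivity), Real.log_pow, Real.log_pow]
      exact_mod_cast hk
    have h2 : 8 * (1 / ε) ^ 2 ≤ (5 / 4 : ℝ) ^ k :=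
      (Real.log_le_log_iff (by positivity) (by positivity)).1 h1
    have h3 : (4 / 5 : ℝ) ^ k * (5 / 4) ^ k = 1 := by
      rw [← mul_pow]; norm_num
    have h4 : (4 / 5 : ℝ) ^ k * (8 * (1 / ε) ^ 2) ≤ 1 :=
      (mul_le_mul_of_nonneg_left h2 (by positivity)).trans_eq h3
    have h5 : (4 / 5 : ℝ) ^ k * 8 ≤ ε ^ 2 := by
      have h6 : (4 / 5 : ℝ) ^ k * 8 = (4 / 5 : ℝ) ^ k * (8 * (1 / ε) ^ 2) * ε ^ 2 := by field_simp
      rw [h6]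
      exact mul_le_of_le_one_left (by positivity) h4
    linarith
  · have h1 : (⌈(Real.log 8 + 2 * L) / Real.log (5 / 4)⌉₊ : ℝ) ≤
        (Real.log 8 + 2 * L) / Real.log (5 / 4) + 1 :=
      (Nat.ceil_lt_add_one (by positivity)).le
    have h2 : c ≤ c / Real.log (1 / ε₀) * L := by
      rw [div_mul_eq_mul_div, le_div_iff₀ hL0]
      exact mul_le_mul_of_nonneg_left hLL hcpos.le
    have h3 : (Real.log 8 + 2 * L) / Real.log (5 / 4) + 1 + 1 = 2 / Real.log (5 / 4) * L + c := by
      rw [hc]; ring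
    rw [add_mul]
    linarith

end FixedPointAA

theorem mainTheorem5 (ε₀ : ℝ) (hε₀ : ε₀ < 1) :
    ∃ C : ℝ, 0 < C ∧ ∀ δ ε : ℝ, 0 < δ → 0 < ε → ε ≤ ε₀ →
      ∃ Φ : FixedPointAA.Circuit,
        (Φ.length : ℝ) ≤ C * (δ⁻¹ * Real.log (1 / ε)) ∧
        ∀ (n : ℕ) (U P : FixedPointAA.Op n) (φ₀ ψ : FixedPointAA.Reg n) (a : ℝ),
          U ∈ Matrix.unitaryGroup (FixedPointAA.Bits n) ℂ →
          IsStarProjection P →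
          ‖φ₀‖ = 1 → ‖ψ‖ = 1 → δ < a →
          Matrix.toEuclideanLin P (Matrix.toEuclideanLin U φ₀) = (a : ℂ) • ψ →
          FixedPointAA.Circuit.toOp U P φ₀ Φ ∈
              Matrix.unitaryGroup (Fin 2 × FixedPointAA.Bits n) ℂ ∧
            ‖FixedPointAA.ketZero ψ -
                Matrix.toEuclideanLin (FixedPointAA.Circuit.toOp U P φ₀ Φ)
                  (FixedPointAA.ketZero φ₀)‖ ≤ ε := by
  obtain ⟨K, hK, hbound⟩ := FixedPointAA.exists_order_bound hε₀
  -- The length is `8(4m+1)(k+1) - 16m + 1`, and `4m + 1 ≤ 15/δ`, so it is at most `121 (k+1)/δ`;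
  -- 144 leaves slack.
  refine ⟨144 * K, by positivity, fun δ ε hδ hε hεle => ?_⟩
  obtain ⟨k, hk, hkK⟩ := hbound ε hε hεle
  have hε1 : ε < 1 := hεle.trans_lt hε₀
  rcases lt_or_ge δ 1 with hδ1 | hδ1
  · have hdiv : 5 / δ = 5 * δ⁻¹ := div_eq_mul_inv 5 δ
    have hδinv : 1 < δ⁻¹ := (one_lt_inv₀ hδ).2 hδ1
    have hceil : 5 / δ / 2 ≤ ⌈5 / δ / 2⌉₊ := Nat.le_ceil _
    have hceil' : (⌈5 / δ / 2⌉₊ : ℝ) < 5 / δ / 2 + 1 := Nat.ceil_lt_add_one (by positivity)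
    set m := ⌈5 / δ / 2⌉₊
    obtain ⟨Φ, hlen, hΦ⟩ :=
      FixedPointAA.exists_circuit hδ hδ1.le hε hε1 (m := m) (by linarith) hk
    refine ⟨Φ, ?_, fun n U P φ ψ a hU hP hφ hψ ha hPU =>
      ⟨FixedPointAA.Circuit.toOp_mem_unitaryGroup hU hP hφ Φ,
        hΦ n U P φ ψ a ⟨hU, hP, hφ, hψ, hδ.trans ha, hPU⟩ ha⟩⟩
    have hm : (4 * m + 1 : ℝ) ≤ 15 * δ⁻¹ := by linarith
    have hk0 : (0 : ℝ) ≤ k := k.cast_nonneg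
    rw [hlen]
    push_cast
    have h1 : (4 * m + 1 : ℝ) * (k + 1) ≤ 15 * δ⁻¹ * (k + 1) :=
      mul_le_mul_of_nonneg_right hm (by linarith)
    have h2 : δ⁻¹ * (k + 1) ≤ δ⁻¹ * (K * Real.log (1 / ε)) :=
      mul_le_mul_of_nonneg_left hkK (by linarith)
    have h3 : 1 ≤ δ⁻¹ * (k + 1) := by nlinarith
    have hm0 : (0 : ℝ) ≤ m := m.cast_nonneg
    nlinarith
  -- For `δ ≥ 1` no instance exists, since amplitudes are at most 1; any circuit serves.
  · refine ⟨[], ?_, fun n U P φ ψ a hU hP hφ hψ ha hPU => ?_⟩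
    · have : 0 ≤ K * Real.log (1 / ε) := le_trans (by positivity) hkK
      have hδi : 0 ≤ δ⁻¹ := by positivity
      simp only [List.length_nil, Nat.cast_zero]
      nlinarith [mul_nonneg hδi this]
    · have h : FixedPointAA.Problem U P φ ψ a := ⟨hU, hP, hφ, hψ, hδ.trans ha, hPU⟩
      exact absurd h.amplitude_le_one (not_le.2 (hδ1.trans_lt ha))
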